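/- Let $P$ be a probability distribution on a measurable space $\mathcal X$, let $\theta$ be a real-valued functional of distributions on $\mathcal X$, and for a sample $x\in\mathcal X^k$ with empirical distribution $P_k$ write $\theta(P_k)$ for the plug-in estimator (measurable in $x$). Let $\tilde\theta$ be a randomized real-valued estimator, defined on samples of every size $n$; its internal randomness is independent of the data and fresh in every call. *Privacy.* A randomized map $M$ on $\mathcal X^n$ is $(\varepsilon,\delta)$-differentially private (DP) if $\mathbb P(M(x)\in O)\le e^{\varepsilon}\,\mathbb P(M(x')\in O)+\delta$ for all measurable $O$ and all $x,x'\in\mathcal X^n$ that differ in at most one observation. *Algorithms.* Let $\mathrm{Med}(v_{1:s})=v_{(\lceil s/2\rceil)}$. - $\mathrm{PrivMedian}(v_{1:s},\varepsilon,\rho,[R_l,R_u])$: let $\mathsf{len}(y;v)$ be the least number of entries of $v$ that must be changed so that the median becomes $y$ (for distinct entries, the number of $i$ with $v_i\in(y,\mathrm{Med}(v)]\cup[\mathrm{Med}(v),y)$), $\mathsf{len}^\rho(y;v)=\inf_{|z-y|<\rho}\mathsf{len}(z;v)$ and $I_\ell=\{y\in[R_l,R_u]:\mathsf{len}^\rho(y;v)=\ell\}$.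 Draw $\ell\in\{0,\dots,s\}$ with probability proportional to $|I_\ell|e^{-\ell\varepsilon/2}$ and return a uniform point of $I_\ell$. - $\mathrm{BootVar}(P_m,n)$, with $N_{\rm mc}\ge1$ Monte Carlo rounds: for $i=1,\dots,N_{\rm mc}$ draw a resample $P^*_{m,n}$ of size $n$ i.i.d. with replacement from $P_m$ and put $\tilde u_i=\sqrt n(\tilde\theta(P^*_{m,n})-\theta(P_m))$; return $\frac1{N_{\rm mc}}\sum_i\tilde u_i^2$. - $\mathrm{BLBvar}$: draw, independently of the data values, $s=\lfloor n/m\rfloor$ disjoint subsamples of size $m$ from the sample, let $v_i$ be the output of $\mathrm{BootVar}$ on the $i$-th one (with resample size $n$), and return $\mathrm{PrivMedian}(v_{1:s},\varepsilon,\rho,[0,\sigma_{\max}^2])$ with $\rho=1/n$ and $\sigma_{\max}^2=n^2$. *Assumptions.* Let $\varepsilon=\varepsilon_n>0$ be bounded above and $\delta=\delta_n\ge0$ (for instance both constant), let $N_{\rm mc}=N_{\rm mc}(n)\ge 1$, and let $m=m(n)$ satisfy $m(n)\to\infty$ and $m(n)=o(n\varepsilon_n/\log n)$. Let $\tilde\theta$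 be $(\varepsilon_n,\delta_n)$-DP on samples of size $n$ for every $n$. For $P_n$ the empirical distribution of $n$ i.i.d. draws from $P$ let $\sigma_n^2=n\,\mathbb E[(\tilde\theta(P_n)-\theta(P))^2]$, finite for all large $n$. Assume that $\tilde\theta$ has typical limiting behavior, that is, $$\sqrt n\,\frac{\tilde\theta(P_n)-\theta(P)}{\sigma_n}\xrightarrow{d}\mathsf N(0,1),$$ and there are $\Delta_n\to0$ such that for all large $n$ the output $\hat v$ of $\mathrm{BootVar}$ on an i.i.d. sample of size $m(n)$ from $P$, with resample size $n$, satisfies $\mathbb P(|\sigma_n^2-\hat v|\le\Delta_n)\ge\frac34$. Assume moreover that the problem is non-degenerate, $\liminf_n\sigma_n^2>0$, and that $\sigma_{\max}^2=n^2$ is a gross upper bound on the second moment, $\limsup_n\sigma_n^2/n^2<1$. *Conclusion.* Let $\alpha\in(0,1)$, let $z_{1-\alpha/2}$ be the $(1-\alpha/2)$-quantile of $\mathsf N(0,1)$, let $\tilde\sigma_n^2$ be the output of $\mathrm{BLBvar}$ on the sample, run with privacy budget $\varepsilon_n$ and with randomness independent of that of $\tilde\theta(P_n)$, and let $$C_\alpha(P_n)=\Big[\tilde\theta(P_n)-n^{-1/2}\tilde\sigma_n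 z_{1-\alpha/2},\ \tilde\theta(P_n)+n^{-1/2}\tilde\sigma_n z_{1-\alpha/2}\Big].$$ Then, for every $n$, $C_\alpha(P_n)$ (as its pair of endpoints) is $(2\varepsilon_n,\delta_n)$-DP, and $$\lim_{n\to\infty}\mathbb P\big(\theta(P)\in C_\alpha(P_n)\big)=1-\alpha .$$ -/

import Mathlib

open MeasureTheory ProbabilityTheory Filter Topology
open scoped ENNReal

noncomputable section

namespace PrivBoot

variable {X : Type*} [MeasurableSpace X]

/-- The empirical distribution of the sample `x`. -/
def empirical {k : ℕ} (x : Fin k → X) : Measure X :=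
  (k : ℝ≥0∞)⁻¹ • ∑ i, Measure.dirac (x i)

/-- The `β`-quantile `inf {t | μ (-∞, t] ≥ β}`. -/
def quant (β : ℝ) (μ : Measure ℝ) : ℝ :=
  sInf {t : ℝ | β ≤ μ.real (Set.Iic t)}

/-- The median, i.e. the `1/2`-quantile of the empirical distribution (the `⌈s/2⌉`-th order
statistic). -/
def median {s : ℕ} (v : Fin s → ℝ) : ℝ := quant (1 / 2) (empirical v)

/-! ### Differential privacy -/

/-- Two samples of size `n` that differ in at most one observation. -/
def Neighbor {n : ℕ} (x x' : Fin n → X) : Prop := ∃ i, ∀ j, j ≠ i → x j = x' j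

/-- A randomized mechanism, given as the map from samples to the law of its output, is
`(ε, δ)`-differentially private. -/
def IsDP {n : ℕ} {Y : Type*} [MeasurableSpace Y] (M : (Fin n → X) → Measure Y) (ε δ : ℝ) :
    Prop :=
  ∀ x x', Neighbor x x' → ∀ O, MeasurableSet O →
    M x O ≤ ENNReal.ofReal (Real.exp ε) * M x' O + ENNReal.ofReal δ

/-! ### The private median: the inverse sensitivity mechanism -/

/-- The inverse sensitivity of the median: the least number of entries of `v` that have to be
changed in order that the median becomes `y`. If the entries of `v` are distinct, this is the
number of entries in `(y, Med v] ∪ [Med v, y)`, see `medianLen_eq_card`. -/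
def medianLen {s : ℕ} (y : ℝ) (v : Fin s → ℝ) : ℕ :=
  sInf {k : ℕ | ∃ v' : Fin s → ℝ, hammingDist v v' = k ∧ median v' = y}

theorem empirical_real_Iic {s : ℕ} (v : Fin s → ℝ) (t : ℝ) :
    (empirical v).real (Set.Iic t) = (s : ℝ)⁻¹ * (Finset.univ.filter fun i => v i ≤ t).card := by
  simp [empirical, Measure.real, Set.indicator_apply, Finset.sum_boole]

theorem median_le_iff {s : ℕ} (hs : 0 < s) (v : Fin s → ℝ) (t : ℝ) :
    median v ≤ t ↔ s ≤ 2 * (Finset.univ.filter fun i => v i ≤ t).card := by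
  have hs' : (0 : ℝ) < s := by exact_mod_cast hs
  have hset : {t : ℝ | 1 / 2 ≤ (empirical v).real (Set.Iic t)} =
      {t : ℝ | s ≤ 2 * (Finset.univ.filter fun i => v i ≤ t).card} := by
    ext t
    simp only [Set.mem_ofPred_eq, empirical_real_Iic]
    rw [inv_mul_eq_div, div_le_div_iff₀ (by norm_num) hs', one_mul, mul_comm]
    exact_mod_cast Iff.rfl
  have : Nonempty (Fin s) := ⟨⟨0, hs⟩⟩
  unfold median quant
  rw [hset]
  have hne : {t : ℝ | s ≤ 2 * (Finset.univ.filter fun i => v i ≤ t).card}.Nonempty := by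
    obtain ⟨M, hM⟩ := (Set.finite_range v).bddAbove
    refine ⟨M, ?_⟩
    have : (Finset.univ.filter fun i => v i ≤ M) = Finset.univ :=
      Finset.filter_true_of_mem fun i _ => hM ⟨i, rfl⟩
    simp only [Set.mem_ofPred_eq, this, Finset.card_univ, Fintype.card_fin]
    omega
  have hbdd : BddBelow {t : ℝ | s ≤ 2 * (Finset.univ.filter fun i => v i ≤ t).card} := by
    obtain ⟨M, hM⟩ := (Set.finite_range v).bddBelow
    refine ⟨M, fun t ht => ?_⟩
    by_contra! h
    have : (Finset.univ.filter fun i => v i ≤ t) = ∅ :=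
      Finset.filter_false_of_mem fun i _ hi => by
        have := hM ⟨i, rfl⟩
        linarith
    simp only [Set.mem_ofPred_eq, this, Finset.card_empty] at ht
    omega
  constructor
  · intro h
    by_contra! hlt
    -- the next data point above `t` is a lower bound larger than `t`
    have hex : (Finset.univ.filter fun i => t < v i).Nonempty := by
      by_contra! hem
      have : (Finset.univ.filter fun i => v i ≤ t) = Finset.univ := by
        ext i
        have hi : i ∉ Finset.univ.filter fun i => t < v i := by simp [hem]
        simpa using hi
      rw [this, Finset.card_univ, Fintype.card_fin] at hlt
      omega
    obtain ⟨i₀, hi₀, hmin⟩ := Finset.exists_min_image _ v hex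
    have hi₀' : t < v i₀ := by simpa using hi₀
    have : v i₀ ≤ sInf {t : ℝ | s ≤ 2 * (Finset.univ.filter fun i => v i ≤ t).card} := by
      refine le_csInf hne fun u hu => ?_
      by_contra! hlt'
      have hsub : (Finset.univ.filter fun i => v i ≤ u).card ≤
          (Finset.univ.filter fun i => v i ≤ t).card := by
        refine Finset.card_le_card fun i hi => ?_
        simp only [Finset.mem_filter, Finset.mem_univ, true_and] at hi ⊢
        by_contra! hti
        have := hmin i (by simpa using hti)
        linarith
      simp only [Set.mem_ofPred_eq] at hu
      omega
    linarith
  · intro h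
    exact csInf_le hbdd h

theorem le_median_iff {s : ℕ} (hs : 0 < s) (v : Fin s → ℝ) (t : ℝ) :
    t ≤ median v ↔ 2 * (Finset.univ.filter fun i => v i < t).card < s := by
  constructor
  · intro h
    by_contra! hle
    have hex : (Finset.univ.filter fun i => v i < t).Nonempty := by
      rw [← Finset.card_pos]
      omega
    obtain ⟨i₀, hi₀, hmax⟩ := Finset.exists_max_image _ v hex
    have hi₀' : v i₀ < t := by simpa using hi₀
    have : median v ≤ v i₀ := by
      rw [median_le_iff hs]
      refine hle.trans (Nat.mul_le_mul_left 2 (Finset.card_le_card fun i hi => ?_))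
      simpa using hmax i hi
    linarith
  · intro h
    by_contra! hlt
    have h1 := (median_le_iff hs v (median v)).1 le_rfl
    have : (Finset.univ.filter fun i => v i ≤ median v).card ≤
        (Finset.univ.filter fun i => v i < t).card := by
      refine Finset.card_le_card fun i hi => ?_
      simp only [Finset.mem_filter, Finset.mem_univ, true_and] at hi ⊢
      linarith
    omega

theorem card_filter_le_add_hammingDist {s : ℕ} (v w : Fin s → ℝ) (p : ℝ → Prop)
    [DecidablePred p] :
    (Finset.univ.filter fun i => p (v i)).card ≤
      (Finset.univ.filter fun i => p (w i)).card + hammingDist v w := by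
  unfold hammingDist
  refine (Finset.card_le_card fun i hi => ?_).trans (Finset.card_union_le _ _)
  simp only [Finset.mem_filter, Finset.mem_univ, true_and, Finset.mem_union] at hi ⊢
  by_cases h : v i = w i
  · left; rwa [← h]
  · right; exact h

/-- For distinct entries the inverse sensitivity is the number of entries between `y` and the
median. -/
theorem medianLen_eq_card {s : ℕ} (y : ℝ) (v : Fin s → ℝ) (hv : Function.Injective v) :
    medianLen y v =
      (Finset.univ.filter fun i => v i ∈ Set.Ioc y (median v) ∪ Set.Ico (median v) y).card := by
  classical
  rcases Nat.eq_zero_or_pos s with rfl | hs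
  · have : ∀ w : Fin 0 → ℝ, hammingDist v w = 0 := fun w => by simp [hammingDist]
    have h0 : medianLen y v = 0 := by
      unfold medianLen
      by_cases h : ∃ w : Fin 0 → ℝ, median w = y
      · obtain ⟨w, hw⟩ := h
        exact Nat.le_zero.1 (Nat.sInf_le ⟨w, this w, hw⟩)
      · exact Nat.sInf_eq_zero.2 (Or.inr (Set.eq_empty_iff_forall_notMem.2
          fun k ⟨w, _, hw⟩ => h ⟨w, hw⟩))
    rw [h0]
    simp
  set c := median v with hc
  have h1 := (median_le_iff hs v c).1 le_rfl
  have h2 := (le_median_iff hs v c).1 le_rfl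
  have h3 : (Finset.univ.filter fun i => v i ≤ c).card ≤
      (Finset.univ.filter fun i => v i < c).card + 1 := by
    have : (Finset.univ.filter fun i => v i = c).card ≤ 1 :=
      Finset.card_le_one.2 fun a ha b hb => hv (by
        rw [(Finset.mem_filter.1 ha).2, (Finset.mem_filter.1 hb).2])
    refine le_trans ?_ (Nat.add_le_add_left this _)
    refine (Finset.card_le_card fun i hi => ?_).trans (Finset.card_union_le _ _)
    simp only [Finset.mem_filter, Finset.mem_univ, true_and, Finset.mem_union] at hi ⊢
    exact hi.lt_or_eq
  set w : Fin s → ℝ := fun i => if v i ∈ Set.Ioc y c ∪ Set.Ico c y then y else v i with hw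
  have hham : hammingDist v w =
      (Finset.univ.filter fun i => v i ∈ Set.Ioc y c ∪ Set.Ico c y).card := by
    unfold hammingDist
    congr 1
    ext i
    simp only [Finset.mem_filter, Finset.mem_univ, true_and, hw]
    split_ifs with h
    · refine iff_of_true ?_ h
      rintro e
      rw [e] at h
      simp at h
    · simp [h]
  have hmed : median w = y := by
    apply le_antisymm
    · rw [median_le_iff hs]
      refine h1.trans (Nat.mul_le_mul_left 2 (Finset.card_le_card fun i hi => ?_))
      simp only [Finset.mem_filter, Finset.mem_univ, true_and, hw, Set.mem_union, Set.mem_Ioc,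
        Set.mem_Ico] at hi ⊢
      grind
    · rw [le_median_iff hs]
      refine lt_of_le_of_lt (Nat.mul_le_mul_left 2 (Finset.card_le_card fun i hi => ?_)) h2
      simp only [Finset.mem_filter, Finset.mem_univ, true_and, hw, Set.mem_union, Set.mem_Ioc,
        Set.mem_Ico] at hi ⊢
      grind
  apply le_antisymm
  · exact Nat.sInf_le ⟨w, hham, hmed⟩
  · refine le_csInf ⟨_, w, hham, hmed⟩ ?_
    rintro k ⟨u, rfl, hu⟩
    have g1 := (median_le_iff hs u y).1 hu.le
    have g2 := (le_median_iff hs u y).1 hu.ge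
    have d1 := card_filter_le_add_hammingDist u v (fun z => z ≤ y)
    have d2 := card_filter_le_add_hammingDist v u (fun z => z < y)
    rw [hammingDist_comm] at d1
    rcases le_total y c with hyc | hyc
    · have e : (Finset.univ.filter fun i => v i ∈ Set.Ioc y c ∪ Set.Ico c y).card +
          (Finset.univ.filter fun i => v i ≤ y).card =
          (Finset.univ.filter fun i => v i ≤ c).card := by
        rw [← Finset.card_union_of_disjoint]
        · congr 1
          ext i
          simp only [Finset.mem_filter, Finset.mem_univ, true_and, Finset.mem_union,
            Set.mem_union, Set.mem_Ioc, Set.mem_Ico]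
          grind
        · rw [Finset.disjoint_left]
          intro i
          simp only [Finset.mem_filter, Finset.mem_univ, true_and, Set.mem_union, Set.mem_Ioc,
            Set.mem_Ico]
          grind
      omega
    · have e : (Finset.univ.filter fun i => v i ∈ Set.Ioc y c ∪ Set.Ico c y).card +
          (Finset.univ.filter fun i => v i < c).card =
          (Finset.univ.filter fun i => v i < y).card := by
        rw [← Finset.card_union_of_disjoint]
        · congr 1
          ext i
          simp only [Finset.mem_filter, Finset.mem_univ, true_and, Finset.mem_union,
            Set.mem_union, Set.mem_Ioc, Set.mem_Ico]
          grind
        · rw [Finset.disjoint_left]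
          intro i
          simp only [Finset.mem_filter, Finset.mem_univ, true_and, Set.mem_union, Set.mem_Ioc,
            Set.mem_Ico]
          grind
      omega

/-- The `ρ`-smoothed length `inf_{|z - y| < ρ} len(z; v)`. -/
def smoothLen (ρ : ℝ) {s : ℕ} (y : ℝ) (v : Fin s → ℝ) : ℕ :=
  sInf ((fun z => medianLen z v) '' {z : ℝ | |z - y| < ρ})

/-- The level sets `I_ℓ = {y ∈ [Rl, Ru] | len^ρ(y; v) = ℓ}`. -/
def levelSet (ρ Rl Ru : ℝ) {s : ℕ} (v : Fin s → ℝ) (l : ℕ) : Set ℝ :=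
  {y : ℝ | y ∈ Set.Icc Rl Ru ∧ smoothLen ρ y v = l}

/-- The weight `|I_ℓ| exp (-ℓ ε / 2)`. -/
def levelWeight (ε ρ Rl Ru : ℝ) {s : ℕ} (v : Fin s → ℝ) (l : ℕ) : ℝ≥0∞ :=
  volume (levelSet ρ Rl Ru v l) * ENNReal.ofReal (Real.exp (-(l * ε / 2)))

/-- The output law of `PrivMedian (v, ε, ρ, [Rl, Ru])`: draw a level `ℓ ∈ {0, …, s}` with
probability proportional to `|I_ℓ| exp (-ℓ ε / 2)`, and return a uniform point of `I_ℓ`. -/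
def privMedian (ε ρ Rl Ru : ℝ) {s : ℕ} (v : Fin s → ℝ) : Measure ℝ :=
  ∑ l ∈ Finset.range (s + 1),
    (levelWeight ε ρ Rl Ru v l / ∑ k ∈ Finset.range (s + 1), levelWeight ε ρ Rl Ru v k) •
      ProbabilityTheory.cond volume (levelSet ρ Rl Ru v l)

/-! ### The bag of little bootstraps

`θ` is the parameter as a functional of distributions, and `κ n x` is the law, over the internal
noise, of the private estimator at the sample `x` of size `n`. -/

/-- The law of the private estimator at a resample of size `n`, drawn i.i.d. with replacement
from the `k` points of `x` (all `k ^ n` index tuples are equally likely). -/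
def resampleLaw (κ : (n : ℕ) → Kernel (Fin n → X) ℝ) (n : ℕ) {k : ℕ} (x : Fin k → X) :
    Measure ℝ :=
  ((k : ℝ≥0∞) ^ n)⁻¹ • ∑ J : Fin n → Fin k, κ n (fun i => x (J i))

/-- The output law of `BootVar` at the sample `x`, with resample size `n` and `N` independent
Monte Carlo rounds. -/
def bootVar (θ : Measure X → ℝ) (κ : (n : ℕ) → Kernel (Fin n → X) ℝ) (n N : ℕ) {k : ℕ}
    (x : Fin k → X) : Measure ℝ :=
  (Measure.pi fun _ : Fin N => resampleLaw κ n x).map fun t =>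
    (1 / (N : ℝ)) * ∑ i, (√(n : ℝ) * (t i - θ (empirical x))) ^ 2

/-- The output law of `BLBvar` at the sample `x`: draw `⌊n / m⌋` disjoint subsamples of size `m`
(subsample `i` consists of the points `x (e (i, j))`, where the injective indexing `e` is drawn
from `S`), run `BootVar` independently on each of them, and apply `PrivMedian` on the interval
`[0, σmax2]` to the results. -/
def blbVar (θ : Measure X → ℝ) (κ : (n : ℕ) → Kernel (Fin n → X) ℝ) (N : ℕ) {n m : ℕ}
    (S : PMF (Fin (n / m) × Fin m ↪ Fin n)) (σmax2 ρ ε : ℝ) (x : Fin n → X) : Measure ℝ :=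
  ∑ e, S e • (Measure.pi fun i => bootVar θ κ n N fun j => x (e (i, j))).bind
    (privMedian ε ρ 0 σmax2)

/-- The law of the confidence interval
`[θ̃ - n^{-1/2} σ̃ z_{1-α/2}, θ̃ + n^{-1/2} σ̃ z_{1-α/2}]` at the sample `x`, coded by its pair of
endpoints, where `θ̃` is the private estimate, `σ̃²` is the output of `BLBvar` with `ρ = 1 / n` and
`σmax² = n²`, and the two runs use independent internal randomness. -/
def confInterval (θ : Measure X → ℝ) (κ : (n : ℕ) → Kernel (Fin n → X) ℝ) (N : ℕ) {n m : ℕ}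
    (S : PMF (Fin (n / m) × Fin m ↪ Fin n)) (ε α : ℝ) (x : Fin n → X) : Measure (ℝ × ℝ) :=
  ((κ n x).prod (blbVar θ κ N S ((n : ℝ) ^ 2) (1 / n) ε x)).map fun p =>
    (p.1 - √p.2 * quant (1 - α / 2) (gaussianReal 0 1) / √(n : ℝ),
      p.1 + √p.2 * quant (1 - α / 2) (gaussianReal 0 1) / √(n : ℝ))

/-! ### Typical limiting behavior -/

/-- The law of the private estimator at an i.i.d. sample of size `n` from `P`. -/
def estimatorLaw (P : Measure X) (κ : (n : ℕ) → Kernel (Fin n → X) ℝ) (n : ℕ) : Measure ℝ :=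
  (Measure.pi fun _ : Fin n => P).bind (κ n)

instance (P : Measure X) [IsProbabilityMeasure P] (κ : (n : ℕ) → Kernel (Fin n → X) ℝ)
    [∀ n, IsMarkovKernel (κ n)] (n : ℕ) : IsProbabilityMeasure (estimatorLaw P κ n) := by
  unfold estimatorLaw; infer_instance

/-- The scaled mean squared error `σ_n² = n E[(θ̃(P_n) - θ(P))²]`. -/
def sigmaSq (P : Measure X) (θ : Measure X → ℝ) (κ : (n : ℕ) → Kernel (Fin n → X) ℝ) (n : ℕ) :
    ℝ :=
  n * ∫ t, (t - θ P) ^ 2 ∂(estimatorLaw P κ n)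

/-- Typical limiting behavior of the private estimator for `θ(P)`: the mean squared error is
finite, `√n (θ̃(P_n) - θ(P)) / σ_n` converges in distribution to `N(0, 1)`, and there are errors
`Δ_n → 0` such that the output `v̂` of `BootVar` at an i.i.d. sample of size `m n`, with resample
size `n`, satisfies `|σ_n² - v̂| ≤ Δ_n` with probability at least `3 / 4`. -/
structure TypicalLimit (P : Measure X) [IsProbabilityMeasure P] (θ : Measure X → ℝ)
    (κ : (n : ℕ) → Kernel (Fin n → X) ℝ) [∀ n, IsMarkovKernel (κ n)] (m N : ℕ → ℕ) : Prop where
  finite_mse : ∀ᶠ n in atTop, Integrable (fun t => (t - θ P) ^ 2) (estimatorLaw P κ n)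
  asymp_normal :
    TendstoInDistribution (fun (n : ℕ) (t : ℝ) => √(n : ℝ) * ((t - θ P) / √(sigmaSq P θ κ n)))
      atTop (id : ℝ → ℝ) (fun n => estimatorLaw P κ n) (gaussianReal 0 1)
  boot_accuracy : ∃ Δ : ℕ → ℝ, Tendsto Δ atTop (𝓝 0) ∧ ∀ᶠ n in atTop,
    3 / 4 ≤ ∫⁻ x, bootVar θ κ n (N n) x {v | |sigmaSq P θ κ n - v| ≤ Δ n}
      ∂(Measure.pi fun _ : Fin (m n) => P)

end PrivBoot

end

noncomputable section

namespace PrivBoot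

variable {X : Type*} [MeasurableSpace X]

/-! ### The inverse sensitivity of the median -/

/-! Privacy. Drawing a level and then a uniform point of it amounts to sampling from the density
proportional to `exp (-ε len^ρ / 2)` on `[Rl, Ru]` (`privMedian_apply`). The smoothed length moves
by at most one when one entry changes (`smoothLen_le_add_one`), so the density and its normalizer
each change by a factor of at most `exp (ε / 2)`. One observation lies in at most one of the
disjoint blocks, so changing it changes at most one factor of the product law of the bootstrap
variances, and `blbVar_le` follows by integration. Composition with the `(ε, δ)`-private estimator
gives `(2ε, δ)`.

Coverage. The disjoint blocks of an i.i.d. sample are i.i.d., and each bootstrap variance is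
accurate with probability at least `3 / 4`, so by a Chernoff bound at least `5 / 8` of the `s`
variances are accurate except with probability `0.97 ^ s` (`lintegral_pi_bootVar_le`). Then every
point farther than `ρ` from the accurate interval has smoothed length at least `s / 8`, while a set
of measure `ρ` around the median has length zero, so the private median misses with probability at
most `(σmax² / ρ) exp (-s ε / 16)` (`privMedian_compl_Icc_le`). Here `σmax² / ρ = n ^ 3`, and `m =
o(n ε / log n)` makes `s ε` larger than any multiple of `log n`, so both errors vanish
(`tendsto_blbError`).

As `σ_n²` stays away from zero, the estimated standard deviation is then within a factor `1 ± η` of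
`σ_n`. This squeezes the coverage between the probabilities that the standardized estimator lies in
`[-w, w]` for `w = (1 ± η) z`; asymptotic normality and continuity of the Gaussian distribution
function finish the argument, as in Slutsky's lemma (`tendsto_of_dilation_bounds`). -/

theorem median_eq_iff {s : ℕ} (hs : 0 < s) (v : Fin s → ℝ) (y : ℝ) :
    median v = y ↔ s ≤ 2 * (Finset.univ.filter fun i => v i ≤ y).card ∧
      2 * (Finset.univ.filter fun i => v i < y).card < s := by
  rw [← median_le_iff hs, ← le_median_iff hs, le_antisymm_iff]

theorem card_lt_le_card_le {s : ℕ} (v : Fin s → ℝ) {a b : ℝ} (h : a ≤ b) :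
    (Finset.univ.filter fun i => v i < a).card ≤ (Finset.univ.filter fun i => v i ≤ b).card :=
  Finset.card_le_card fun i hi => by
    simp only [Finset.mem_filter, Finset.mem_univ, true_and] at hi ⊢
    linarith

theorem hammingDist_replace_le {s : ℕ} (v : Fin s → ℝ) (T : Finset (Fin s)) (y : ℝ) :
    hammingDist v (fun i => if i ∈ T then y else v i) ≤ T.card := by
  classical
  unfold hammingDist
  refine Finset.card_le_card fun i hi => ?_
  simp only [Finset.mem_filter, Finset.mem_univ, true_and] at hi
  by_contra h
  simp [h] at hi

theorem medianLen_le_hammingDist {s : ℕ} {y : ℝ} (v : Fin s → ℝ) {w : Fin s → ℝ}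
    (h : median w = y) : medianLen y v ≤ hammingDist v w :=
  Nat.sInf_le ⟨w, rfl, h⟩

theorem smoothLen_le_medianLen {s : ℕ} {ρ y z : ℝ} (v : Fin s → ℝ) (h : |z - y| < ρ) :
    smoothLen ρ y v ≤ medianLen z v :=
  Nat.sInf_le ⟨z, h, rfl⟩

/-- The inverse sensitivity of the median in terms of counts, with ties allowed. -/
theorem medianLen_eq {s : ℕ} (hs : 0 < s) (y : ℝ) (v : Fin s → ℝ) :
    medianLen y v = ((s + 1) / 2 - (Finset.univ.filter fun i => v i ≤ y).card) +
      ((Finset.univ.filter fun i => v i < y).card + 1 - (s + 1) / 2) := by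
  classical
  have hle := card_lt_le_card_le v (le_refl y)
  have hsplit : (Finset.univ.filter fun i => v i ≤ y).card +
      (Finset.univ.filter fun i => y < v i).card = s := by
    have := Finset.card_filter_add_card_filter_not (s := (Finset.univ : Finset (Fin s)))
      (fun i => v i ≤ y)
    simpa using this
  apply le_antisymm
  · -- replace the required number of entries by `y`
    rcases lt_or_ge (Finset.univ.filter fun i => v i ≤ y).card ((s + 1) / 2) with h | h
    · obtain ⟨T, hT, hTc⟩ := Finset.exists_subset_card_eq
        (s := Finset.univ.filter fun i => y < v i)
        (n := (s + 1) / 2 - (Finset.univ.filter fun i => v i ≤ y).card) (by omega)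
      set w : Fin s → ℝ := fun i => if i ∈ T then y else v i with hw
      have hmed : median w = y := by
        rw [median_eq_iff hs]
        constructor
        · have : (Finset.univ.filter fun i => v i ≤ y) ∪ T ⊆
              Finset.univ.filter fun i => w i ≤ y := by
            intro i hi
            simp only [Finset.mem_union, Finset.mem_filter, Finset.mem_univ, true_and, hw] at hi ⊢
            split_ifs with hiT <;> simp_all
          have h2 := Finset.card_le_card this
          rw [Finset.card_union_of_disjoint] at h2
          · omega
          · rw [Finset.disjoint_left]
            intro i hi hiT
            have := hT hiT
            simp only [Finset.mem_filter, Finset.mem_univ, true_and] at this hi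
            linarith
        · have : (Finset.univ.filter fun i => w i < y) ⊆ Finset.univ.filter fun i => v i < y := by
            intro i hi
            simp only [Finset.mem_filter, Finset.mem_univ, true_and, hw] at hi ⊢
            split_ifs at hi with hiT
            · simp at hi
            · exact hi
          have h2 := Finset.card_le_card this
          omega
      have : hammingDist v w ≤ T.card := hammingDist_replace_le v T y
      exact (medianLen_le_hammingDist v hmed).trans (by omega)
    · obtain ⟨T, hT, hTc⟩ := Finset.exists_subset_card_eq
        (s := Finset.univ.filter fun i => v i < y)
        (n := (Finset.univ.filter fun i => v i < y).card + 1 - (s + 1) / 2) (by omega)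
      set w : Fin s → ℝ := fun i => if i ∈ T then y else v i with hw
      have hmed : median w = y := by
        rw [median_eq_iff hs]
        constructor
        · have : (Finset.univ.filter fun i => v i ≤ y) ⊆ Finset.univ.filter fun i => w i ≤ y := by
            intro i hi
            simp only [Finset.mem_filter, Finset.mem_univ, true_and, hw] at hi ⊢
            split_ifs with hiT <;> simp_all
          have h2 := Finset.card_le_card this
          omega
        · have : (Finset.univ.filter fun i => w i < y) ⊆
              (Finset.univ.filter fun i => v i < y) \ T := by
            intro i hi
            simp only [Finset.mem_sdiff, Finset.mem_filter, Finset.mem_univ, true_and, hw] at hi ⊢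
            split_ifs at hi with hiT
            · simp at hi
            · exact ⟨hi, hiT⟩
          have h2 := Finset.card_le_card this
          rw [Finset.card_sdiff_of_subset hT] at h2
          omega
      have : hammingDist v w ≤ T.card := hammingDist_replace_le v T y
      exact (medianLen_le_hammingDist v hmed).trans (by omega)
  · refine le_csInf ⟨_, fun _ => y, rfl, ?_⟩ ?_
    · rw [median_eq_iff hs]
      simp
      omega
    · rintro k ⟨u, rfl, hu⟩
      obtain ⟨g1, g2⟩ := (median_eq_iff hs u y).1 hu
      have d1 := card_filter_le_add_hammingDist u v (fun z => z ≤ y)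
      have d2 := card_filter_le_add_hammingDist v u (fun z => z < y)
      rw [hammingDist_comm] at d1
      omega

/-- Finitely many points leave a gap below `b`. Hence the extremal counts over the open window of
radius `ρ` are attained inside it. -/
theorem exists_forall_lt_imp_le {s : ℕ} (v : Fin s → ℝ) (b : ℝ) :
    ∃ z < b, ∀ i, v i < b → v i ≤ z := by
  classical
  induction s with
  | zero => exact ⟨b - 1, by linarith, fun i => i.elim0⟩
  | succ s ih =>
    obtain ⟨z, hz, h⟩ := ih (fun i => v i.succ)
    by_cases h0 : v 0 < b
    · refine ⟨max z (v 0), max_lt hz h0, fun i => ?_⟩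
      refine Fin.cases (fun _ => le_max_right _ _) (fun j hj => (h j hj).trans (le_max_left _ _)) i
    · refine ⟨z, hz, fun i => ?_⟩
      exact Fin.cases (fun hj => absurd hj h0) (fun j hj => h j hj) i

/-- The smoothed inverse sensitivity in terms of counts. -/
theorem smoothLen_eq {s : ℕ} (hs : 0 < s) {ρ : ℝ} (hρ : 0 < ρ) (y : ℝ) (v : Fin s → ℝ) :
    smoothLen ρ y v = ((s + 1) / 2 - (Finset.univ.filter fun i => v i < y + ρ).card) +
      ((Finset.univ.filter fun i => v i ≤ y - ρ).card + 1 - (s + 1) / 2) := by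
  have key : ∀ z, |z - y| < ρ → (Finset.univ.filter fun i => v i ≤ z).card ≤
      (Finset.univ.filter fun i => v i < y + ρ).card ∧
      (Finset.univ.filter fun i => v i ≤ y - ρ).card ≤
      (Finset.univ.filter fun i => v i < z).card := by
    intro z hz
    rw [abs_lt] at hz
    constructor <;>
    · refine Finset.card_le_card fun i hi => ?_
      simp only [Finset.mem_filter, Finset.mem_univ, true_and] at hi ⊢
      linarith
  apply le_antisymm
  -- No single `z` need optimize both counts, but only one term matters on each side of the median:
  -- `z` is pushed towards the median, and if the median lies in the window both terms vanish.
  · rcases le_or_gt (y + ρ) (median v) with hc | hc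
    · obtain ⟨z, hz, hzv⟩ := exists_forall_lt_imp_le v (y + ρ)
      -- The gap point may lie below the window; the maximum with `y` brings it back without
      -- lowering the count.
      set z' := max z y with hz'
      have hzy : |z' - y| < ρ := by
        rw [abs_lt]
        exact ⟨by linarith [le_max_right z y], by linarith [max_lt hz (by linarith : y < y + ρ)]⟩
      refine (smoothLen_le_medianLen v hzy).trans ?_
      rw [medianLen_eq hs]
      have h1 : (Finset.univ.filter fun i => v i < y + ρ).card ≤
          (Finset.univ.filter fun i => v i ≤ z').card := by
        refine Finset.card_le_card fun i hi => ?_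
        simp only [Finset.mem_filter, Finset.mem_univ, true_and] at hi ⊢
        exact (hzv i hi).trans (le_max_left _ _)
      have h2 := (le_median_iff hs v z').1 (by rw [abs_lt] at hzy; linarith)
      omega
    · rcases le_or_gt (median v) (y - ρ) with hc' | hc'
      · obtain ⟨z, hz, hzv⟩ := exists_forall_lt_imp_le (fun i => -v i) (-(y - ρ))
        set z' := min (-z) y with hz'
        have hzy : |z' - y| < ρ := by
          rw [abs_lt]
          exact ⟨by linarith [lt_min (by linarith : y - ρ < -z) (by linarith : y - ρ < y)],
            by linarith [min_le_right (-z) y]⟩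
        refine (smoothLen_le_medianLen v hzy).trans ?_
        rw [medianLen_eq hs]
        have h1 : (Finset.univ.filter fun i => v i < z').card ≤
            (Finset.univ.filter fun i => v i ≤ y - ρ).card := by
          refine Finset.card_le_card fun i hi => ?_
          simp only [Finset.mem_filter, Finset.mem_univ, true_and] at hi ⊢
          by_contra! hlt
          have := hzv i (by linarith)
          linarith [min_le_left (-z) y]
        have h2 := (median_le_iff hs v z').1 (by rw [abs_lt] at hzy; linarith)
        omega
      · have hzy : |median v - y| < ρ := by
          rw [abs_lt]; constructor <;> linarith
        refine (smoothLen_le_medianLen v hzy).trans ?_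
        rw [medianLen_eq hs]
        have h1 := (median_le_iff hs v (median v)).1 le_rfl
        have h2 := (le_median_iff hs v (median v)).1 le_rfl
        omega
  · refine le_csInf ⟨_, y, by simpa using hρ, rfl⟩ ?_
    rintro k ⟨z, hz, rfl⟩
    simp only
    rw [medianLen_eq hs]
    have := key z hz
    omega

/-- This makes the levels `0, …, s` exhaust `[Rl, Ru]`. -/
theorem smoothLen_le {s : ℕ} (hs : 0 < s) {ρ : ℝ} (hρ : 0 < ρ) (y : ℝ) (v : Fin s → ℝ) :
    smoothLen ρ y v ≤ s := by
  rw [smoothLen_eq hs hρ]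
  have h1 := Finset.card_le_univ (Finset.univ.filter fun i => v i ≤ y - ρ)
  have h2 : (Finset.univ.filter fun i => v i ≤ y - ρ).card ≤
      (Finset.univ.filter fun i => v i < y + ρ).card := by
    refine Finset.card_le_card fun i hi => ?_
    simp only [Finset.mem_filter, Finset.mem_univ, true_and] at hi ⊢
    linarith
  rw [Fintype.card_fin] at h1
  omega

theorem Neighbor.hammingDist_le {s : ℕ} {v w : Fin s → ℝ} (h : Neighbor v w) :
    hammingDist v w ≤ 1 := by
  obtain ⟨i, hi⟩ := h
  unfold hammingDist
  rw [Finset.card_le_one_iff]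
  intro a b ha hb
  simp only [Finset.mem_filter, Finset.mem_univ, true_and] at ha hb
  have h1 : a = i := by by_contra h; exact ha (hi a h)
  have h2 : b = i := by by_contra h; exact hb (hi b h)
  rw [h1, h2]

theorem Neighbor.symm {Y : Type*} {s : ℕ} {v w : Fin s → Y} (h : Neighbor v w) : Neighbor w v :=
  h.imp fun _ hi j hj => (hi j hj).symm

theorem smoothLen_le_add_one {s : ℕ} (hs : 0 < s) {ρ : ℝ} (hρ : 0 < ρ) (y : ℝ) {v w : Fin s → ℝ}
    (h : Neighbor v w) : smoothLen ρ y v ≤ smoothLen ρ y w + 1 := by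
  rw [smoothLen_eq hs hρ, smoothLen_eq hs hρ]
  have d := h.hammingDist_le
  have d1 := card_filter_le_add_hammingDist w v (fun z => z < y + ρ)
  have d2 := card_filter_le_add_hammingDist v w (fun z => z ≤ y - ρ)
  rw [hammingDist_comm] at d1
  -- This keeps one of the two terms zero; otherwise both could grow by one.
  have h1 : (Finset.univ.filter fun i => v i ≤ y - ρ).card ≤
      (Finset.univ.filter fun i => v i < y + ρ).card := by
    refine Finset.card_le_card fun i hi => ?_
    simp only [Finset.mem_filter, Finset.mem_univ, true_and] at hi ⊢
    linarith
  omega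

theorem measurable_smoothLen {s : ℕ} (hs : 0 < s) {ρ : ℝ} (hρ : 0 < ρ) :
    Measurable fun p : (Fin s → ℝ) × ℝ => smoothLen ρ p.2 p.1 := by
  have hcard : ∀ q : Fin s → (Fin s → ℝ) × ℝ → Prop, ∀ [∀ i p, Decidable (q i p)],
      (∀ i, MeasurableSet {p | q i p}) →
      Measurable fun p => (Finset.univ.filter fun i => q i p).card := by
    intro q _ hq
    simp_rw [Finset.card_filter]
    exact Finset.measurable_sum _ fun i _ => Measurable.ite (hq i) measurable_const measurable_const
  simp_rw [smoothLen_eq hs hρ]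
  have h1 := hcard (fun i p => p.1 i < p.2 + ρ) fun i =>
    measurableSet_lt (by fun_prop) (by fun_prop)
  have h2 := hcard (fun i p => p.1 i ≤ p.2 - ρ) fun i =>
    measurableSet_le (by fun_prop) (by fun_prop)
  exact (measurable_from_top (f := fun a : ℕ => (s + 1) / 2 - a)).comp h1 |>.add
    ((measurable_from_top (f := fun a : ℕ => a + 1 - (s + 1) / 2)).comp h2)

/-! ### The output law of the private median -/

/-- The unnormalized density of the private median. -/
def lenDensity (ε ρ : ℝ) {s : ℕ} (v : Fin s → ℝ) (y : ℝ) : ℝ≥0∞ :=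
  ENNReal.ofReal (Real.exp (-(smoothLen ρ y v * ε / 2)))

theorem measurable_lenDensity {s : ℕ} (hs : 0 < s) (ε : ℝ) {ρ : ℝ} (hρ : 0 < ρ) :
    Measurable fun p : (Fin s → ℝ) × ℝ => lenDensity ε ρ p.1 p.2 :=
  (measurable_from_top (f := fun l : ℕ => ENNReal.ofReal (Real.exp (-(l * ε / 2))))).comp
    (measurable_smoothLen hs hρ)

theorem measurableSet_levelSet {s : ℕ} (hs : 0 < s) {ρ : ℝ} (hρ : 0 < ρ) (Rl Ru : ℝ)
    (v : Fin s → ℝ) (l : ℕ) : MeasurableSet (levelSet ρ Rl Ru v l) :=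
  measurableSet_Icc.inter
    (((measurable_smoothLen hs hρ).comp measurable_prodMk_left) (measurableSet_singleton l))

theorem setLIntegral_lenDensity {s : ℕ} (hs : 0 < s) (ε : ℝ) {ρ : ℝ} (hρ : 0 < ρ) (Rl Ru : ℝ)
    (v : Fin s → ℝ) {A : Set ℝ} (hA : MeasurableSet A) :
    ∫⁻ y in Set.Icc Rl Ru ∩ A, lenDensity ε ρ v y = ∑ l ∈ Finset.range (s + 1),
      volume (levelSet ρ Rl Ru v l ∩ A) * ENNReal.ofReal (Real.exp (-(l * ε / 2))) := by
  have hmeas := measurableSet_levelSet hs hρ Rl Ru v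
  have hU : Set.Icc Rl Ru ∩ A = ⋃ l ∈ Finset.range (s + 1), (levelSet ρ Rl Ru v l ∩ A) := by
    ext y
    simp only [Set.mem_inter_iff, Set.mem_iUnion, levelSet, Set.mem_ofPred_eq, Finset.mem_range,
      exists_prop]
    constructor
    · rintro ⟨h1, h2⟩
      exact ⟨_, Nat.lt_succ_of_le (smoothLen_le hs hρ y v), ⟨h1, rfl⟩, h2⟩
    · rintro ⟨l, _, ⟨h1, _⟩, h2⟩
      exact ⟨h1, h2⟩
  rw [hU, lintegral_biUnion_finset]
  · refine Finset.sum_congr rfl fun l _ => ?_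
    rw [setLIntegral_congr_fun ((hmeas l).inter hA)
      (g := fun _ => ENNReal.ofReal (Real.exp (-(l * ε / 2))))]
    · rw [setLIntegral_const, mul_comm]
    · rintro y ⟨⟨_, hy⟩, _⟩
      simp only [lenDensity, hy]
  · intro l _ k _ hlk
    refine Set.disjoint_left.2 ?_
    rintro y ⟨⟨_, h1⟩, _⟩ ⟨⟨_, h2⟩, _⟩
    exact hlk (h1.symm.trans h2)
  · exact fun l _ => (hmeas l).inter hA

/-- The factor `|I_ℓ|` in the weight of a level cancels the normalization of the uniform draw from
it. Null levels have weight zero, so the value of `cond` there is irrelevant. -/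
theorem privMedian_apply {s : ℕ} (hs : 0 < s) (ε : ℝ) {ρ : ℝ} (hρ : 0 < ρ) (Rl Ru : ℝ)
    (v : Fin s → ℝ) {A : Set ℝ} (hA : MeasurableSet A) :
    privMedian ε ρ Rl Ru v A = (∫⁻ y in Set.Icc Rl Ru ∩ A, lenDensity ε ρ v y) /
      ∫⁻ y in Set.Icc Rl Ru, lenDensity ε ρ v y := by
  have hZ : ∫⁻ y in Set.Icc Rl Ru, lenDensity ε ρ v y =
      ∑ k ∈ Finset.range (s + 1), levelWeight ε ρ Rl Ru v k := by
    have := setLIntegral_lenDensity hs ε hρ Rl Ru v MeasurableSet.univ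
    simpa [levelWeight] using this
  rw [setLIntegral_lenDensity hs ε hρ Rl Ru v hA, hZ, ENNReal.div_eq_inv_mul, Finset.mul_sum]
  simp only [privMedian, Measure.coe_finsetSum, Finset.sum_apply, Measure.smul_apply,
    smul_eq_mul]
  refine Finset.sum_congr rfl fun l _ => ?_
  rw [cond_apply (measurableSet_levelSet hs hρ Rl Ru v l), ENNReal.div_eq_inv_mul, mul_assoc]
  congr 1
  by_cases h0 : volume (levelSet ρ Rl Ru v l) = 0
  · rw [levelWeight, h0, measure_mono_null Set.inter_subset_left h0]
    simp
  have htop : volume (levelSet ρ Rl Ru v l) ≠ ∞ :=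
    ((measure_mono fun _ h => h.1).trans_lt (measure_Icc_lt_top (a := Rl) (b := Ru))).ne
  rw [levelWeight, mul_right_comm, ← mul_assoc, ENNReal.mul_inv_cancel h0 htop, one_mul]

/-- Free of conditions on the parameters, so that the privacy claim holds for every `n`, even when
there are no blocks. -/
theorem privMedian_univ_le_one (ε ρ Rl Ru : ℝ) {s : ℕ} (v : Fin s → ℝ) :
    privMedian ε ρ Rl Ru v Set.univ ≤ 1 := by
  simp only [privMedian, Measure.coe_finsetSum, Finset.sum_apply, Measure.smul_apply,
    smul_eq_mul]
  calc _ ≤ ∑ l ∈ Finset.range (s + 1), levelWeight ε ρ Rl Ru v l /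
        ∑ k ∈ Finset.range (s + 1), levelWeight ε ρ Rl Ru v k := by
        refine Finset.sum_le_sum fun l _ => mul_le_of_le_one_right' ?_
        rw [ProbabilityTheory.cond, Measure.smul_apply, Measure.restrict_apply_univ, smul_eq_mul]
        exact ENNReal.inv_mul_le_one _
    _ ≤ 1 := by
        simp_rw [div_eq_mul_inv]
        rw [← Finset.sum_mul]
        exact ENNReal.mul_inv_le_one _

theorem privMedian_univ {s : ℕ} (hs : 0 < s) (ε : ℝ) {ρ : ℝ} (hρ : 0 < ρ) {Rl Ru : ℝ}
    (hR : Rl < Ru) (hε : 0 ≤ ε) (v : Fin s → ℝ) :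
    privMedian ε ρ Rl Ru v Set.univ = 1 := by
  rw [privMedian_apply hs ε hρ Rl Ru v MeasurableSet.univ, Set.inter_univ]
  refine ENNReal.div_self ?_ ?_
  · refine (setLIntegral_pos_iff
      ((measurable_lenDensity hs ε hρ).comp measurable_prodMk_left)).2 ?_ |>.ne'
    have : Function.support (fun y => lenDensity ε ρ v y) = Set.univ :=
      Set.eq_univ_of_forall fun y => by
        simp [lenDensity, Real.exp_pos]
    change 0 < volume (Function.support (fun y => lenDensity ε ρ v y) ∩ Set.Icc Rl Ru)
    rw [this, Set.univ_inter, Real.volume_Icc]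
    simpa using hR
  · refine ((setLIntegral_mono measurable_const (g := fun _ => 1) fun y _ => ?_).trans_lt ?_).ne
    · rw [lenDensity, ← ENNReal.ofReal_one]
      refine ENNReal.ofReal_le_ofReal (Real.exp_le_one_iff.2 ?_)
      have : 0 ≤ smoothLen ρ y v * ε / 2 := by positivity
      linarith
    · simp

theorem measurable_privMedian (ε : ℝ) {ρ : ℝ} (hρ : 0 < ρ) (Rl Ru : ℝ) (s : ℕ) :
    Measurable (privMedian ε ρ Rl Ru : (Fin s → ℝ) → Measure ℝ) := by
  rcases Nat.eq_zero_or_pos s with rfl | hs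
  · exact measurable_of_finite _
  refine Measure.measurable_of_measurable_coe _ fun A hA => ?_
  simp_rw [privMedian_apply hs ε hρ Rl Ru _ hA]
  exact (measurable_lenDensity hs ε hρ).lintegral_prod_right'.div
    (measurable_lenDensity hs ε hρ).lintegral_prod_right'

theorem lenDensity_le {s : ℕ} (hs : 0 < s) {ε ρ : ℝ} (hε : 0 ≤ ε) (hρ : 0 < ρ) {v w : Fin s → ℝ}
    (h : Neighbor v w) (y : ℝ) :
    lenDensity ε ρ v y ≤ ENNReal.ofReal (Real.exp (ε / 2)) * lenDensity ε ρ w y := by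
  rw [lenDensity, lenDensity, ← ENNReal.ofReal_mul (Real.exp_pos _).le, ← Real.exp_add]
  refine ENNReal.ofReal_le_ofReal (Real.exp_le_exp.2 ?_)
  have h1 : (smoothLen ρ y w : ℝ) ≤ smoothLen ρ y v + 1 := by
    exact_mod_cast smoothLen_le_add_one hs hρ y h.symm
  nlinarith

/-- The private median is `(ε, 0)`-differentially private. -/
theorem privMedian_le {s : ℕ} {ε ρ : ℝ} (hε : 0 ≤ ε) (hρ : 0 < ρ) (Rl Ru : ℝ)
    {v w : Fin s → ℝ} (h : Neighbor v w) {A : Set ℝ} (hA : MeasurableSet A) :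
    privMedian ε ρ Rl Ru v A ≤ ENNReal.ofReal (Real.exp ε) * privMedian ε ρ Rl Ru w A := by
  have hs : 0 < s := by obtain ⟨i, _⟩ := h; exact i.pos
  set c := ENNReal.ofReal (Real.exp (ε / 2)) with hc
  have hc0 : c ≠ 0 := by simp [hc, Real.exp_pos]
  have hct : c ≠ ∞ := ENNReal.ofReal_ne_top
  have key : ∀ (v w : Fin s → ℝ), Neighbor v w → ∀ B : Set ℝ,
      ∫⁻ y in B, lenDensity ε ρ v y ≤ c * ∫⁻ y in B, lenDensity ε ρ w y := by
    intro v w h B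
    rw [← lintegral_const_mul' _ _ hct]
    exact lintegral_mono fun y => lenDensity_le hs hε hρ h y
  have hcc : ENNReal.ofReal (Real.exp ε) = c * c := by
    rw [hc, ← ENNReal.ofReal_mul (Real.exp_pos _).le, ← Real.exp_add, add_halves]
  rw [privMedian_apply hs ε hρ Rl Ru v hA, privMedian_apply hs ε hρ Rl Ru w hA, hcc,
    div_eq_mul_inv, div_eq_mul_inv]
  -- The normalizer costs a second factor `exp (ε / 2)`, hence the halved exponent in the weights.
  have hinv : (∫⁻ y in Set.Icc Rl Ru, lenDensity ε ρ v y)⁻¹ ≤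
      c * (∫⁻ y in Set.Icc Rl Ru, lenDensity ε ρ w y)⁻¹ := by
    have := ENNReal.inv_le_inv.2 (key w v h.symm (Set.Icc Rl Ru))
    rw [ENNReal.mul_inv (Or.inl hc0) (Or.inl hct)] at this
    calc _ = c * (c⁻¹ * (∫⁻ y in Set.Icc Rl Ru, lenDensity ε ρ v y)⁻¹) := by
          rw [← mul_assoc, ENNReal.mul_inv_cancel hc0 hct, one_mul]
      _ ≤ _ := by gcongr
  calc _ ≤ (c * ∫⁻ y in Set.Icc Rl Ru ∩ A, lenDensity ε ρ w y) *
        (c * (∫⁻ y in Set.Icc Rl Ru, lenDensity ε ρ w y)⁻¹) := mul_le_mul' (key v w h _) hinv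
    _ = _ := by ring

/-- If at least `5 / 8` of the entries lie in `[a, b]`, then so does the private median up to `ρ`,
with high probability. -/
theorem privMedian_compl_Icc_le {s : ℕ} (hs : 0 < s) {ε ρ : ℝ} (hε : 0 ≤ ε) (hρ : 0 < ρ)
    {Rl Ru a b : ℝ} (ha : Rl ≤ a) (hb : b + ρ ≤ Ru) (v : Fin s → ℝ)
    (hv : 5 * s ≤ 8 * (Finset.univ.filter fun i => v i ∈ Set.Icc a b).card) :
    privMedian ε ρ Rl Ru v (Set.Icc (a - ρ) (b + ρ))ᶜ ≤
      ENNReal.ofReal ((Ru - Rl) * Real.exp (-(s * ε / 16)) / ρ) := by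
  have hlow : ∀ t ≤ a, (Finset.univ.filter fun i => v i ∈ Set.Icc a b).card +
      (Finset.univ.filter fun i => v i < t).card ≤ s := by
    intro t ht
    rw [← Finset.card_union_of_disjoint]
    · exact (Finset.card_le_univ _).trans (Fintype.card_fin s).le
    · rw [Finset.disjoint_left]
      intro i h1 h2
      simp only [Finset.mem_filter, Finset.mem_univ, true_and, Set.mem_Icc] at h1 h2
      linarith
  have hhigh : ∀ t ≥ b, (Finset.univ.filter fun i => v i ∈ Set.Icc a b).card ≤
      (Finset.univ.filter fun i => v i ≤ t).card := by
    intro t ht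
    refine Finset.card_le_card fun i hi => ?_
    simp only [Finset.mem_filter, Finset.mem_univ, true_and, Set.mem_Icc] at hi ⊢
    linarith
  have hmb : median v ≤ b := by
    rw [median_le_iff hs]
    have := hhigh b le_rfl
    omega
  have hma : a ≤ median v := by
    rw [le_median_iff hs]
    have := hlow a le_rfl
    omega
  -- To the left at most `3 s / 8` entries are below `y + ρ`, to the right at least `5 s / 8` are at
  -- most `y - ρ`; both differ from `s / 2` by `s / 8`.
  have hfar : ∀ y ∉ Set.Icc (a - ρ) (b + ρ), s ≤ 8 * smoothLen ρ y v := by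
    intro y hy
    rw [smoothLen_eq hs hρ]
    rw [Set.mem_Icc, not_and_or, not_le, not_le] at hy
    rcases hy with hy | hy
    · have := hlow (y + ρ) (by linarith)
      omega
    · have := hhigh (y - ρ) (by linarith)
      omega
  rw [privMedian_apply hs ε hρ Rl Ru v measurableSet_Icc.compl, ENNReal.ofReal_div_of_pos hρ]
  refine ENNReal.div_le_div ?_ ?_
  · calc ∫⁻ y in Set.Icc Rl Ru ∩ (Set.Icc (a - ρ) (b + ρ))ᶜ, lenDensity ε ρ v y
        ≤ ∫⁻ _ in Set.Icc Rl Ru ∩ (Set.Icc (a - ρ) (b + ρ))ᶜ,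
          ENNReal.ofReal (Real.exp (-(s * ε / 16))) := by
          refine setLIntegral_mono measurable_const fun y hy => ?_
          refine ENNReal.ofReal_le_ofReal (Real.exp_le_exp.2 ?_)
          have : (s : ℝ) ≤ 8 * smoothLen ρ y v := by exact_mod_cast hfar y hy.2
          nlinarith
      _ ≤ ∫⁻ _ in Set.Icc Rl Ru, ENNReal.ofReal (Real.exp (-(s * ε / 16))) :=
          lintegral_mono_set Set.inter_subset_left
      _ = _ := by
          rw [setLIntegral_const, Real.volume_Icc, ← ENNReal.ofReal_mul (Real.exp_pos _).le,
            mul_comm]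
  -- The density is `1` within `ρ` of the median. Only the right half of that window is used: `hb`
  -- keeps it in `[Rl, Ru]`, whereas the left half may leave it.
  · calc ENNReal.ofReal ρ = ∫⁻ _ in Set.Ico (median v) (median v + ρ), 1 := by
          rw [setLIntegral_const, Real.volume_Ico, one_mul, add_sub_cancel_left]
      _ ≤ ∫⁻ y in Set.Ico (median v) (median v + ρ), lenDensity ε ρ v y := by
          refine setLIntegral_mono' measurableSet_Ico fun y hy => ?_
          have h1 := (median_le_iff hs v (median v)).1 le_rfl
          have h2 := (le_median_iff hs v (median v)).1 le_rfl
          have h0 : medianLen (median v) v = 0 := by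
            rw [medianLen_eq hs]
            omega
          have : smoothLen ρ y v = 0 := Nat.le_zero.1
            ((smoothLen_le_medianLen v (by
              rw [abs_lt]; constructor <;> linarith [hy.1, hy.2])).trans h0.le)
          simp [lenDensity, this]
      _ ≤ ∫⁻ y in Set.Icc Rl Ru, lenDensity ε ρ v y :=
          lintegral_mono_set fun y hy => Set.mem_Icc.2 ⟨by linarith [hy.1], by linarith [hy.2]⟩

/-! ### Product measures -/

theorem measurable_pi_measure {α β ι : Type*} [MeasurableSpace α] [MeasurableSpace β] [Fintype ι]
    {μ : α → ι → Measure β} [∀ a i, IsProbabilityMeasure (μ a i)]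
    (hμ : ∀ i, Measurable fun a => μ a i) : Measurable fun a => Measure.pi (μ a) := by
  refine Measurable.measure_of_isPiSystem_of_isProbabilityMeasure generateFrom_pi.symm
    isPiSystem_pi ?_
  rintro _ ⟨t, ht, rfl⟩
  simp_rw [Measure.pi_pi]
  exact Finset.measurable_prod _ fun i _ =>
    (Measure.measurable_coe (ht i (Set.mem_univ i))).comp (hμ i)

theorem lintegral_pi_prod {ι β : Type*} [Fintype ι] [MeasurableSpace β] (μ : ι → Measure β)
    [∀ i, IsProbabilityMeasure (μ i)] {f : ι → β → ℝ≥0∞} (hf : ∀ i, Measurable (f i)) :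
    ∫⁻ v, ∏ i, f i (v i) ∂(Measure.pi μ) = ∏ i, ∫⁻ t, f i t ∂(μ i) := by
  refine (lintegral_prod_eq_prod_lintegral_of_indepFun Finset.univ
    (fun i (v : ι → β) => f i (v i)) (iIndepFun_pi fun i => (hf i).aemeasurable)
    (fun i => (hf i).comp (measurable_pi_apply i))).trans ?_
  exact Finset.prod_congr rfl fun i _ =>
    (measurePreserving_eval μ i).lintegral_comp (hf i)

/-- If `f` changes by a factor of at most `c` when one coordinate is changed, then so does its
integral with respect to a product measure when one factor is changed. -/
theorem lintegral_pi_le_of_neighbor {β : Type*} [MeasurableSpace β] {s : ℕ}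
    (μ μ' : Fin s → Measure β) [∀ i, IsProbabilityMeasure (μ i)]
    [∀ i, IsProbabilityMeasure (μ' i)] (h : Neighbor μ μ') {f : (Fin s → β) → ℝ≥0∞}
    (hf : Measurable f) {c : ℝ≥0∞} (hc : ∀ v w, Neighbor v w → f v ≤ c * f w) :
    ∫⁻ v, f v ∂(Measure.pi μ) ≤ c * ∫⁻ v, f v ∂(Measure.pi μ') := by
  obtain ⟨i, hi⟩ := h
  cases s with
  | zero => exact i.elim0
  | succ t =>
    have hμ : (fun j => μ (i.succAbove j)) = fun j => μ' (i.succAbove j) :=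
      funext fun j => hi _ (Fin.succAbove_ne i j)
    have hm := (MeasurableEquiv.piFinSuccAbove (fun _ : Fin (t + 1) => β) i).symm.measurable
    have split : ∀ (ν : Fin (t + 1) → Measure β) [∀ i, IsProbabilityMeasure (ν i)],
        ∫⁻ v, f v ∂(Measure.pi ν) = ∫⁻ r, ∫⁻ a,
          f ((MeasurableEquiv.piFinSuccAbove (fun _ => β) i).symm (a, r)) ∂(ν i)
            ∂(Measure.pi fun j => ν (i.succAbove j)) := by
      intro ν _
      rw [← ((measurePreserving_piFinSuccAbove ν i).symm).lintegral_comp hf]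
      exact lintegral_prod_symm _ (hf.comp hm).aemeasurable
    rw [split μ, split μ', hμ, ← lintegral_const_mul _
      (Measurable.lintegral_prod_left' (f := fun p : β × (Fin t → β) =>
        f ((MeasurableEquiv.piFinSuccAbove (fun _ => β) i).symm p)) (hf.comp hm))]
    refine lintegral_mono fun r => ?_
    have hmr : Measurable fun a : β =>
        f ((MeasurableEquiv.piFinSuccAbove (fun _ => β) i).symm (a, r)) :=
      (hf.comp hm).comp measurable_prodMk_right
    -- With the other coordinates fixed at `r`, `f (a, r) ≤ c f (b, r)` for all `a` and `b`;
    -- averaging over independent `a` and `b` compares the two unrelated marginals.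
    calc _ ≤ ∫⁻ _, c * ∫⁻ b, f ((MeasurableEquiv.piFinSuccAbove (fun _ => β) i).symm (b, r))
            ∂(μ' i) ∂(μ i) := by
          refine lintegral_mono fun a => ?_
          rw [← lintegral_const_mul _ hmr]
          calc _ = ∫⁻ _, f ((MeasurableEquiv.piFinSuccAbove (fun _ => β) i).symm (a, r))
                ∂(μ' i) := by simp
            _ ≤ _ := by
              refine lintegral_mono fun b => hc _ _ ⟨i, fun j hj => ?_⟩
              obtain ⟨k, rfl⟩ := Fin.exists_succAbove_eq hj
              change i.insertNth (α := fun _ => β) a r _ = i.insertNth (α := fun _ => β) b r _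
              simp
      _ = _ := by simp

/-! ### The bag of little bootstraps -/

section Boot

variable (θ : Measure X → ℝ) (κ : (n : ℕ) → Kernel (Fin n → X) ℝ)

theorem isProbabilityMeasure_resampleLaw [∀ n, IsMarkovKernel (κ n)] (n : ℕ) {k : ℕ} (hk : 0 < k)
    (x : Fin k → X) : IsProbabilityMeasure (resampleLaw κ n x) := by
  constructor
  simp only [resampleLaw, Measure.smul_apply, Measure.coe_finsetSum, Finset.sum_apply,
    measure_univ, smul_eq_mul, Finset.sum_const, Finset.card_univ, Fintype.card_fun,
    Fintype.card_fin, nsmul_eq_mul, mul_one, Nat.cast_pow]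
  exact ENNReal.inv_mul_cancel (by simp [hk.ne']) (by simp)

theorem measurable_resampleLaw (n k : ℕ) :
    Measurable (resampleLaw κ n : (Fin k → X) → Measure ℝ) := by
  refine Measure.measurable_of_measurable_coe _ fun A hA => ?_
  simp only [resampleLaw, Measure.smul_apply, Measure.coe_finsetSum, Finset.sum_apply, smul_eq_mul]
  refine (Finset.measurable_sum _ fun J _ => ?_).const_mul _
  exact ((κ n).measurable_coe hA).comp (by fun_prop)

theorem measurable_bootStat (n N : ℕ) (c : ℝ) : Measurable fun t : Fin N → ℝ =>
    (1 / (N : ℝ)) * ∑ i, (√(n : ℝ) * (t i - c)) ^ 2 := by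
  fun_prop

theorem isProbabilityMeasure_bootVar [∀ n, IsMarkovKernel (κ n)] (n N : ℕ) {k : ℕ} (hk : 0 < k)
    (x : Fin k → X) : IsProbabilityMeasure (bootVar θ κ n N x) := by
  have := isProbabilityMeasure_resampleLaw κ n hk x
  exact Measure.isProbabilityMeasure_map (measurable_bootStat n N _).aemeasurable

variable {θ} in
theorem measurable_bootVar [∀ n, IsMarkovKernel (κ n)] {k : ℕ} (hk : 0 < k)
    (hθ : Measurable fun x : Fin k → X => θ (empirical x)) (n N : ℕ) :
    Measurable (bootVar θ κ n N : (Fin k → X) → Measure ℝ) := by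
  have hp := isProbabilityMeasure_resampleLaw κ n hk
  have hpi : Measurable fun x : Fin k → X => Measure.pi fun _ : Fin N => resampleLaw κ n x :=
    measurable_pi_measure (μ := fun (x : Fin k → X) (_ : Fin N) => resampleLaw κ n x)
      fun _ => measurable_resampleLaw κ n k
  -- The sample enters the statistic through `θ` as well as the law, so joint measurability and
  -- sections of a kernel are needed.
  let K : Kernel (Fin k → X) (Fin N → ℝ) := ⟨_, hpi⟩
  have : IsMarkovKernel K := ⟨fun x => by
    change IsProbabilityMeasure (Measure.pi fun _ : Fin N => resampleLaw κ n x)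
    infer_instance⟩
  refine Measure.measurable_of_measurable_coe _ fun A hA => ?_
  simp_rw [bootVar, Measure.map_apply (measurable_bootStat n N _) hA]
  have hstat : Measurable fun p : (Fin k → X) × (Fin N → ℝ) =>
      (1 / (N : ℝ)) * ∑ i, (√(n : ℝ) * (p.2 i - θ (empirical p.1))) ^ 2 := by
    have : Measurable fun p : (Fin k → X) × (Fin N → ℝ) => θ (empirical p.1) :=
      hθ.comp measurable_fst
    exact (Finset.measurable_sum _ fun i _ => ((((measurable_pi_apply i).comp
      measurable_snd).sub this).const_mul _).pow_const 2).const_mul _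
  exact Kernel.measurable_kernel_prodMk_left (κ := K) (hstat hA)

variable {n m : ℕ} (N : ℕ) (S : PMF (Fin (n / m) × Fin m ↪ Fin n))

theorem sum_pmf {γ : Type*} [Fintype γ] (p : PMF γ) : ∑ e, p e = 1 := by
  rw [← tsum_fintype (L := .unconditional _), p.tsum_coe]

/-- For `m = 0` the convention `n / 0 = 0` leaves no blocks. -/
theorem pos_of_fin_div (i : Fin (n / m)) : 0 < m := by
  rcases Nat.eq_zero_or_pos m with rfl | h
  · rw [Nat.div_zero] at i
    exact i.elim0
  · exact h

theorem blbVar_apply (σmax2 ε : ℝ) {ρ : ℝ} (hρ : 0 < ρ) (x : Fin n → X) {A : Set ℝ}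
    (hA : MeasurableSet A) :
    blbVar θ κ N S σmax2 ρ ε x A = ∑ e, S e * ∫⁻ v, privMedian ε ρ 0 σmax2 v A
      ∂(Measure.pi fun i => bootVar θ κ n N fun j => x (e (i, j))) := by
  simp only [blbVar, Measure.coe_finsetSum, Finset.sum_apply, Measure.smul_apply, smul_eq_mul]
  refine Finset.sum_congr rfl fun e _ => ?_
  rw [Measure.bind_apply hA (measurable_privMedian ε hρ 0 σmax2 _).aemeasurable]

theorem isProbabilityMeasure_pi_bootVar [∀ n, IsMarkovKernel (κ n)] (x : Fin n → X)
    (e : Fin (n / m) × Fin m → Fin n) (i : Fin (n / m)) :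
    IsProbabilityMeasure (bootVar θ κ n N fun j => x (e (i, j))) :=
  isProbabilityMeasure_bootVar θ κ n N (pos_of_fin_div i) _

theorem blbVar_univ_le_one [∀ n, IsMarkovKernel (κ n)] (σmax2 ε : ℝ) {ρ : ℝ} (hρ : 0 < ρ)
    (x : Fin n → X) : blbVar θ κ N S σmax2 ρ ε x Set.univ ≤ 1 := by
  rw [blbVar_apply θ κ N S σmax2 ε hρ x MeasurableSet.univ, ← sum_pmf S]
  refine Finset.sum_le_sum fun e _ => mul_le_of_le_one_right' ?_
  have := isProbabilityMeasure_pi_bootVar θ κ N x e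
  calc _ ≤ ∫⁻ _, 1 ∂(Measure.pi fun i => bootVar θ κ n N fun j => x (e (i, j))) :=
        lintegral_mono fun v => privMedian_univ_le_one _ _ _ _ v
    _ = 1 := by simp

theorem blbVar_univ [∀ n, IsMarkovKernel (κ n)] (hs : 0 < n / m) {σmax2 ε ρ : ℝ}
    (hσ : 0 < σmax2) (hε : 0 ≤ ε) (hρ : 0 < ρ) (x : Fin n → X) :
    blbVar θ κ N S σmax2 ρ ε x Set.univ = 1 := by
  rw [blbVar_apply θ κ N S σmax2 ε hρ x MeasurableSet.univ, ← sum_pmf S]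
  refine Finset.sum_congr rfl fun e _ => ?_
  have := isProbabilityMeasure_pi_bootVar θ κ N x e
  simp [privMedian_univ hs ε hρ hσ hε]

/-- The bag of little bootstraps variance estimate is `(ε, 0)`-differentially private. -/
theorem blbVar_le [∀ n, IsMarkovKernel (κ n)] (σmax2 : ℝ) {ε ρ : ℝ} (hε : 0 ≤ ε) (hρ : 0 < ρ)
    {x x' : Fin n → X} (h : Neighbor x x') :
    blbVar θ κ N S σmax2 ρ ε x ≤ ENNReal.ofReal (Real.exp ε) • blbVar θ κ N S σmax2 ρ ε x' := by
  refine Measure.le_iff.2 fun A hA => ?_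
  rw [Measure.smul_apply, blbVar_apply θ κ N S σmax2 ε hρ x hA,
    blbVar_apply θ κ N S σmax2 ε hρ x' hA, smul_eq_mul, Finset.mul_sum]
  refine Finset.sum_le_sum fun e _ => ?_
  rw [mul_left_comm]
  gcongr
  have h1 := isProbabilityMeasure_pi_bootVar θ κ N x e
  have h2 := isProbabilityMeasure_pi_bootVar θ κ N x' e
  obtain ⟨i, hi⟩ := h
  have hmeas : Measurable fun v : Fin (n / m) → ℝ => privMedian ε ρ 0 σmax2 v A :=
    (Measure.measurable_coe hA).comp (measurable_privMedian ε hρ 0 σmax2 _)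
  -- By injectivity of `e` the changed observation lies in exactly one block, or it is unused.
  by_cases hex : ∃ p, e p = i
  · obtain ⟨⟨a, b⟩, hab⟩ := hex
    refine lintegral_pi_le_of_neighbor _ _ ⟨a, fun j hj => ?_⟩ hmeas
      fun v w hvw => privMedian_le hε hρ 0 σmax2 hvw hA
    congr 1
    funext k
    refine hi _ fun hk => hj ?_
    rw [← hab] at hk
    exact (Prod.ext_iff.1 (e.injective hk)).1
  · have : (fun i => bootVar θ κ n N fun j => x (e (i, j))) =
        fun i => bootVar θ κ n N fun j => x' (e (i, j)) := by
      funext a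
      congr 1
      funext k
      exact hi _ fun hk => hex ⟨_, hk⟩
    rw [this]
    refine le_mul_of_one_le_left' ?_
    rw [← ENNReal.ofReal_one]
    exact ENNReal.ofReal_le_ofReal (Real.one_le_exp hε)

theorem measurable_intervalEndpoints (z r : ℝ) : Measurable fun p : ℝ × ℝ =>
    (p.1 - √p.2 * z / r, p.1 + √p.2 * z / r) := by
  fun_prop

/-- The confidence interval is `(2ε, δ)`-differentially private. -/
theorem confInterval_isDP [∀ n, IsMarkovKernel (κ n)] {ε δ : ℝ} (hε : 0 ≤ ε)
    (hκ : IsDP (κ n) ε δ) (α : ℝ) : IsDP (confInterval θ κ N S ε α) (2 * ε) δ := by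
  intro x x' h O hO
  have hn : 0 < n := by obtain ⟨i, _⟩ := h; exact i.pos
  have hρ : (0 : ℝ) < 1 / n := by positivity
  have hfin : ∀ x, IsFiniteMeasure (blbVar θ κ N S ((n : ℝ) ^ 2) (1 / n) ε x) := fun x =>
    ⟨(blbVar_univ_le_one θ κ N S _ ε hρ x).trans_lt ENNReal.one_lt_top⟩
  have hf := measurable_intervalEndpoints (quant (1 - α / 2) (gaussianReal 0 1)) √(n : ℝ)
  simp only [confInterval]
  rw [Measure.map_apply hf hO, Measure.map_apply hf hO]
  set T := (fun p : ℝ × ℝ => (p.1 - √p.2 * quant (1 - α / 2) (gaussianReal 0 1) / √(n : ℝ),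
      p.1 + √p.2 * quant (1 - α / 2) (gaussianReal 0 1) / √(n : ℝ))) ⁻¹' O with hT
  have hTm : MeasurableSet T := hf hO
  set c := ENNReal.ofReal (Real.exp ε) with hc
  have hcc : ENNReal.ofReal (Real.exp (2 * ε)) = c * c := by
    rw [hc, ← ENNReal.ofReal_mul (Real.exp_pos _).le, ← Real.exp_add, two_mul]
  have hsec : Measurable fun b => κ n x' ((fun a => (a, b)) ⁻¹' T) :=
    measurable_measure_prodMk_right hTm
  rw [Measure.prod_apply_symm hTm, Measure.prod_apply_symm hTm, hcc]
  -- Replacing `x` in the estimator first, while the variance law still sits at `x`, leaves `δ`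
  -- multiplied only by a mass of at most `1` and not by `exp ε`.
  calc ∫⁻ b, κ n x ((fun a => (a, b)) ⁻¹' T) ∂(blbVar θ κ N S ((n : ℝ) ^ 2) (1 / n) ε x)
      ≤ ∫⁻ b, (c * κ n x' ((fun a => (a, b)) ⁻¹' T) + ENNReal.ofReal δ)
        ∂(blbVar θ κ N S ((n : ℝ) ^ 2) (1 / n) ε x) :=
        lintegral_mono fun b => hκ x x' h _ (measurable_prodMk_right hTm)
    _ = c * ∫⁻ b, κ n x' ((fun a => (a, b)) ⁻¹' T) ∂(blbVar θ κ N S ((n : ℝ) ^ 2) (1 / n) ε x) +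
        ENNReal.ofReal δ * blbVar θ κ N S ((n : ℝ) ^ 2) (1 / n) ε x Set.univ := by
        rw [lintegral_add_right _ measurable_const, lintegral_const_mul _ hsec, lintegral_const]
    _ ≤ c * (c * ∫⁻ b, κ n x' ((fun a => (a, b)) ⁻¹' T)
          ∂(blbVar θ κ N S ((n : ℝ) ^ 2) (1 / n) ε x')) + ENNReal.ofReal δ := by
        refine add_le_add (mul_le_mul_right ?_ _)
          (mul_le_of_le_one_right' (blbVar_univ_le_one θ κ N S _ ε hρ x))
        rw [← smul_eq_mul, ← lintegral_smul_measure]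
        exact lintegral_mono' (blbVar_le θ κ N S _ hε hρ h) le_rfl
    _ = _ := by rw [mul_assoc]

end Boot

/-! ### Accuracy of the bag of little bootstraps -/

/-- Injectivity of `e` makes the blocks independent; currying groups the coordinates. -/
theorem map_pi_blocks (P : Measure X) [IsProbabilityMeasure P] {n : ℕ} {ι κ : Type*} [Fintype ι]
    [Fintype κ] (e : ι × κ ↪ Fin n) :
    (Measure.pi fun _ : Fin n => P).map (fun x (i : ι) (j : κ) => x (e (i, j))) =
      Measure.pi fun _ : ι => Measure.pi fun _ : κ => P := by
  have h1 := Measure.map_infinitePi_infinitePi_of_inj (P := fun _ : Fin n => P) e.injective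
  have h2 := Measure.infinitePi_map_curry (fun (_ : ι) (_ : κ) => P)
  simp only [Measure.infinitePi_eq_pi] at h1 h2
  rw [← h2, ← h1, Measure.map_map (MeasurableEquiv.measurable _) (by fun_prop)]
  rfl

/-- If less than `5 / 8` of the entries lie in `G`, then the product of the weights is at
least `1`. -/
theorem one_le_prod_weights {s : ℕ} (G : Set ℝ) [DecidablePred (· ∈ G)] (v : Fin s → ℝ)
    (hv : 8 * (Finset.univ.filter fun i => v i ∈ G).card < 5 * s) :
    1 ≤ ∏ i, ENNReal.ofReal (if v i ∈ G then ((11 / 10 : ℝ) ^ 3)⁻¹ else (11 / 10) ^ 5) := by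
  rw [← ENNReal.ofReal_prod_of_nonneg (fun i _ => by split_ifs <;> positivity),
    ← ENNReal.ofReal_one, Finset.prod_ite, Finset.prod_const, Finset.prod_const]
  refine ENNReal.ofReal_le_ofReal ?_
  have hsplit := Finset.card_filter_add_card_filter_not (s := (Finset.univ : Finset (Fin s)))
      (fun i => v i ∈ G)
  rw [Finset.card_univ, Fintype.card_fin] at hsplit
  rw [inv_pow, ← pow_mul, ← pow_mul, inv_mul_eq_div, one_le_div (by positivity)]
  exact pow_le_pow_right₀ (by norm_num) (by omega)

/-- The exponents `-3` and `5` balance at a fraction `5 / 8` of good entries, whereas at `3 / 4` the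
mean exponent is `-1`, so a base slightly above `1` gives mean weight below `1`. With base `1.1` the
mean is at most about `0.966`. -/
theorem lintegral_weights_le (ν : Measure ℝ) [IsProbabilityMeasure ν] {G : Set ℝ}
    [DecidablePred (· ∈ G)] (hG : MeasurableSet G) (hν : 3 / 4 ≤ ν G) :
    ∫⁻ t, ENNReal.ofReal (if t ∈ G then ((11 / 10 : ℝ) ^ 3)⁻¹ else (11 / 10) ^ 5) ∂ν ≤
      ENNReal.ofReal (97 / 100) := by
  have hi : ∀ t, ENNReal.ofReal (if t ∈ G then ((11 / 10 : ℝ) ^ 3)⁻¹ else (11 / 10) ^ 5) =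
      G.indicator (fun _ => ENNReal.ofReal ((11 / 10 : ℝ) ^ 3)⁻¹) t +
        Gᶜ.indicator (fun _ => ENNReal.ofReal ((11 / 10) ^ 5)) t := by
    intro t
    by_cases ht : t ∈ G <;> simp [ht]
  have hν' : 3 / 4 ≤ ν.real G := by
    have := ENNReal.toReal_mono (measure_ne_top ν G) hν
    simpa [ENNReal.toReal_div, Measure.real] using this
  have hc : ν.real Gᶜ = 1 - ν.real G := probReal_compl_eq_one_sub hG
  simp_rw [hi]
  rw [lintegral_add_left (measurable_const.indicator hG), lintegral_indicator_const hG,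
    lintegral_indicator_const hG.compl, ← ofReal_measureReal (s := G),
    ← ofReal_measureReal (s := Gᶜ), ← ENNReal.ofReal_mul (by positivity),
    ← ENNReal.ofReal_mul (by positivity), ← ENNReal.ofReal_add (by positivity) (by positivity), hc]
  refine ENNReal.ofReal_le_ofReal ?_
  norm_num
  linarith

section Boot

variable {P : Measure X} [IsProbabilityMeasure P] {θ : Measure X → ℝ}
  {κ : (n : ℕ) → Kernel (Fin n → X) ℝ} [∀ n, IsMarkovKernel (κ n)] {n m N : ℕ}

theorem measurable_pi_bootVar (hθ : ∀ k : ℕ, Measurable fun x : Fin k → X => θ (empirical x))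
    (e : Fin (n / m) × Fin m → Fin n) :
    Measurable fun x : Fin n → X =>
      Measure.pi fun i => bootVar θ κ n N fun j => x (e (i, j)) := by
  have := fun (x : Fin n → X) (i : Fin (n / m)) => isProbabilityMeasure_pi_bootVar θ κ N x e i
  refine measurable_pi_measure
    (μ := fun (x : Fin n → X) i => bootVar θ κ n N fun j => x (e (i, j))) fun i => ?_
  exact (measurable_bootVar κ (pos_of_fin_div i) (hθ m) n N).comp (by fun_prop)

/-- A Chernoff bound: it is unlikely that less than `5 / 8` of the bootstrap variances are
accurate. -/
theorem lintegral_pi_bootVar_le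
    (hθ : ∀ k : ℕ, Measurable fun x : Fin k → X => θ (empirical x)) (hm : 0 < m)
    (e : Fin (n / m) × Fin m ↪ Fin n) {G : Set ℝ} [DecidablePred (· ∈ G)] (hG : MeasurableSet G)
    (h : 3 / 4 ≤ ∫⁻ x, bootVar θ κ n N x G ∂(Measure.pi fun _ : Fin m => P)) :
    ∫⁻ x, (Measure.pi fun i => bootVar θ κ n N fun j => x (e (i, j)))
        {v | 8 * (Finset.univ.filter fun i => v i ∈ G).card < 5 * (n / m)}
        ∂(Measure.pi fun _ : Fin n => P) ≤ ENNReal.ofReal (97 / 100) ^ (n / m) := by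
  set f : ℝ → ℝ≥0∞ :=
    fun t => ENNReal.ofReal (if t ∈ G then ((11 / 10 : ℝ) ^ 3)⁻¹ else (11 / 10) ^ 5) with hf
  have hfm : Measurable f :=
    (Measurable.ite hG measurable_const measurable_const).ennreal_ofReal
  have hboot := measurable_bootVar κ hm (hθ m) n N
  have hg : Measurable fun y : Fin m → X => ∫⁻ t, f t ∂(bootVar θ κ n N y) :=
    (Measure.measurable_lintegral hfm).comp hboot
  have hprob := isProbabilityMeasure_bootVar θ κ n N hm
  -- Accuracy is assumed only on average over the sample, hence the mixture.
  set ν := (Measure.pi fun _ : Fin m => P).bind (bootVar θ κ n N) with hν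
  have : IsProbabilityMeasure ν :=
    isProbabilityMeasure_bind hboot.aemeasurable (ae_of_all _ hprob)
  have hmean : ∫⁻ y, ∫⁻ t, f t ∂(bootVar θ κ n N y) ∂(Measure.pi fun _ : Fin m => P) ≤
      ENNReal.ofReal (97 / 100) := by
    rw [← Measure.lintegral_bind hboot.aemeasurable hfm.aemeasurable]
    refine lintegral_weights_le ν hG ?_
    rwa [hν, Measure.bind_apply hG hboot.aemeasurable]
  -- Markov's inequality for the product of weights. Its mean factorizes twice: given the sample, by
  -- independence of the runs, and then by independence of the blocks.
  calc _ ≤ ∫⁻ x, ∏ i, ∫⁻ t, f t ∂(bootVar θ κ n N fun j => x (e (i, j)))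
        ∂(Measure.pi fun _ : Fin n => P) := by
        refine lintegral_mono fun x => ?_
        have := isProbabilityMeasure_pi_bootVar θ κ N x e
        rw [← lintegral_pi_prod _ (fun _ => hfm)]
        refine (measure_mono fun v hv => ?_).trans (meas_ge_le_lintegral_div (ε := 1)
          (f := fun v : Fin (n / m) → ℝ => ∏ i, f (v i)) ?_ one_ne_zero
            ENNReal.one_ne_top |>.trans (by rw [div_one]))
        · exact one_le_prod_weights G v hv
        · exact (Finset.measurable_prod _ fun i _ => hfm.comp (measurable_pi_apply i)).aemeasurable
    _ = ∫⁻ y, ∏ i, ∫⁻ t, f t ∂(bootVar θ κ n N (y i))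
          ∂(Measure.pi fun _ : Fin (n / m) => Measure.pi fun _ : Fin m => P) := by
        rw [← map_pi_blocks P e, lintegral_map]
        · exact Finset.measurable_prod _ fun i _ => hg.comp (measurable_pi_apply i)
        · fun_prop
    _ = (∫⁻ y, ∫⁻ t, f t ∂(bootVar θ κ n N y) ∂(Measure.pi fun _ : Fin m => P)) ^ (n / m) := by
        rw [lintegral_pi_prod (fun _ : Fin (n / m) => Measure.pi fun _ : Fin m => P)
          (fun _ => hg)]
        simp
    _ ≤ _ := by gcongr

theorem measurable_blbVar_apply
    (hθ : ∀ k : ℕ, Measurable fun x : Fin k → X => θ (empirical x))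
    (S : PMF (Fin (n / m) × Fin m ↪ Fin n)) (σmax2 ε : ℝ) {ρ : ℝ} (hρ : 0 < ρ) {A : Set ℝ}
    (hA : MeasurableSet A) : Measurable fun x => blbVar θ κ N S σmax2 ρ ε x A := by
  simp_rw [blbVar_apply θ κ N S σmax2 ε hρ _ hA]
  refine Finset.measurable_sum _ fun e _ => Measurable.const_mul ?_ _
  exact (Measure.measurable_lintegral ((Measure.measurable_coe hA).comp
    (measurable_privMedian ε hρ 0 σmax2 _))).comp (measurable_pi_bootVar hθ e)

/-- The bag of little bootstraps variance estimate is as accurate as a single run of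
`BootVar`. -/
theorem lintegral_blbVar_compl_Icc_le
    (hθ : ∀ k : ℕ, Measurable fun x : Fin k → X => θ (empirical x))
    (hs : 0 < n / m) (S : PMF (Fin (n / m) × Fin m ↪ Fin n)) {σmax2 ε ρ a b : ℝ} (hε : 0 ≤ ε)
    (hρ : 0 < ρ) (ha : 0 ≤ a) (hb : b + ρ ≤ σmax2)
    (h : 3 / 4 ≤ ∫⁻ x, bootVar θ κ n N x (Set.Icc a b) ∂(Measure.pi fun _ : Fin m => P)) :
    ∫⁻ x, blbVar θ κ N S σmax2 ρ ε x (Set.Icc (a - ρ) (b + ρ))ᶜ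
        ∂(Measure.pi fun _ : Fin n => P) ≤
      ENNReal.ofReal (97 / 100) ^ (n / m) +
        ENNReal.ofReal (σmax2 * Real.exp (-((n / m : ℕ) * ε / 16)) / ρ) := by
  classical
  have hm : 0 < m := pos_of_fin_div ⟨0, hs⟩
  have hF : MeasurableSet (Set.Icc (a - ρ) (b + ρ))ᶜ := measurableSet_Icc.compl
  set C := ENNReal.ofReal (σmax2 * Real.exp (-((n / m : ℕ) * ε / 16)) / ρ) with hC
  simp_rw [blbVar_apply θ κ N S σmax2 ε hρ _ hF]
  have hmeas : ∀ e : Fin (n / m) × Fin m ↪ Fin n, Measurable fun x : Fin n → X =>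
      ∫⁻ v, privMedian ε ρ 0 σmax2 v (Set.Icc (a - ρ) (b + ρ))ᶜ
        ∂(Measure.pi fun i => bootVar θ κ n N fun j => x (e (i, j))) := fun e =>
    (Measure.measurable_lintegral ((Measure.measurable_coe hF).comp
      (measurable_privMedian ε hρ 0 σmax2 _))).comp (measurable_pi_bootVar hθ e)
  rw [lintegral_finsetSum _ fun e _ => (hmeas e).const_mul _]
  have hbad : MeasurableSet {v : Fin (n / m) → ℝ |
      8 * (Finset.univ.filter fun i => v i ∈ Set.Icc a b).card < 5 * (n / m)} := by
    have : Measurable fun v : Fin (n / m) → ℝ =>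
        8 * (Finset.univ.filter fun i => v i ∈ Set.Icc a b).card := by
      simp_rw [Finset.card_filter]
      refine (Finset.measurable_sum _ fun i _ => Measurable.ite ?_ measurable_const
        measurable_const).const_mul _
      exact measurable_pi_apply i measurableSet_Icc
    exact this measurableSet_Iio
  -- The bound is uniform in `e`, so the law of the subsampling is irrelevant.
  calc _ ≤ ∑ e, S e * (ENNReal.ofReal (97 / 100) ^ (n / m) + C) := by
        refine Finset.sum_le_sum fun e _ => ?_
        rw [lintegral_const_mul _ (hmeas e)]
        gcongr
        calc _ ≤ ∫⁻ x, ((Measure.pi fun i => bootVar θ κ n N fun j => x (e (i, j)))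
              {v | 8 * (Finset.univ.filter fun i => v i ∈ Set.Icc a b).card < 5 * (n / m)} + C)
              ∂(Measure.pi fun _ : Fin n => P) := by
              refine lintegral_mono fun x => ?_
              have := isProbabilityMeasure_pi_bootVar θ κ N x e
              rw [← lintegral_indicator_one hbad]
              calc _ ≤ ∫⁻ v, ({v : Fin (n / m) → ℝ | 8 * (Finset.univ.filter fun i =>
                    v i ∈ Set.Icc a b).card < 5 * (n / m)}.indicator 1 v + C)
                    ∂(Measure.pi fun i => bootVar θ κ n N fun j => x (e (i, j))) := by
                    refine lintegral_mono fun v => ?_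
                    by_cases hv : 8 * (Finset.univ.filter fun i =>
                        v i ∈ Set.Icc a b).card < 5 * (n / m)
                    · rw [Set.indicator_of_mem (by exact hv)]
                      refine le_add_right ?_
                      exact (measure_mono (Set.subset_univ _)).trans
                        (privMedian_univ_le_one _ _ _ _ v)
                    · refine le_add_left ?_
                      have := privMedian_compl_Icc_le hs hε hρ ha hb v (not_lt.1 hv)
                      rwa [sub_zero] at this
                _ = _ := by
                    rw [lintegral_add_right _ measurable_const]
                    simp
          _ ≤ _ := by
              rw [lintegral_add_right _ measurable_const, lintegral_const, measure_univ, mul_one]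
              gcongr
              exact lintegral_pi_bootVar_le hθ hm e measurableSet_Icc h
    _ = _ := by rw [← Finset.sum_mul, sum_pmf, one_mul]

end Boot

/-! ### The standard normal distribution -/

/-- Up to a constant the distribution function is the primitive of `1`, which is continuous without
atoms. -/
theorem continuous_real_Iic (μ : Measure ℝ) [IsFiniteMeasure μ] [NullSingletonClass μ] :
    Continuous fun t => μ.real (Set.Iic t) := by
  have h := (integrable_const (μ := μ) (1 : ℝ)).continuous_primitive 0
  have he : (fun t => μ.real (Set.Iic t)) =
      fun t => (∫ _ in (0 : ℝ)..t, (1 : ℝ) ∂μ) + μ.real (Set.Iic 0) := by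
    funext t
    rw [← intervalIntegral.integral_Iic_sub_Iic (integrable_const _).integrableOn
      (integrable_const _).integrableOn]
    simp
  rw [he]
  exact h.add continuous_const

/-- The quantile of a continuous distribution is attained. -/
theorem real_Iic_quant (μ : Measure ℝ) [IsProbabilityMeasure μ] [NullSingletonClass μ] {β : ℝ}
    (hβ : β ∈ Set.Ioo (0 : ℝ) 1) : μ.real (Set.Iic (quant β μ)) = β := by
  have hc := continuous_real_Iic μ
  have hmono : Monotone fun t => μ.real (Set.Iic t) := fun a b hab =>
    measureReal_mono (Set.Iic_subset_Iic.2 hab)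
  have hbot : Tendsto (fun t => μ.real (Set.Iic t)) atBot (𝓝 0) := by
    simpa only [← cdf_eq_real] using tendsto_cdf_atBot μ
  have htop : Tendsto (fun t => μ.real (Set.Iic t)) atTop (𝓝 1) := by
    simpa only [← cdf_eq_real] using tendsto_cdf_atTop μ
  obtain ⟨b, hb⟩ := (htop.eventually (lt_mem_nhds hβ.2)).exists
  obtain ⟨a, ha⟩ := (hbot.eventually (gt_mem_nhds hβ.1)).exists
  have hab : a ≤ b := by
    by_contra! h
    have := hmono h.le
    simp only at this
    linarith
  obtain ⟨t, -, ht⟩ := intermediate_value_Icc hab hc.continuousOn ⟨ha.le, hb.le⟩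
  have hbdd : BddBelow {t : ℝ | β ≤ μ.real (Set.Iic t)} := by
    refine ⟨a, fun u hu => ?_⟩
    by_contra! h
    have := hmono h.le
    simp only [Set.mem_ofPred_eq] at this hu
    linarith
  apply le_antisymm
  · exact (hmono (csInf_le hbdd ht.ge)).trans ht.le
  · exact (isClosed_le continuous_const hc).csInf_mem ⟨t, ht.ge⟩ hbdd

instance : NullSingletonClass (gaussianReal 0 1) := nullSingletonClass_gaussianReal one_ne_zero

theorem gaussianReal_real_Iic_neg (w : ℝ) :
    (gaussianReal 0 1).real (Set.Iic (-w)) = 1 - (gaussianReal 0 1).real (Set.Iic w) := by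
  have h : (gaussianReal 0 1).real (Set.Iic (-w)) = (gaussianReal 0 1).real (Set.Ici w) := by
    have hneg := gaussianReal_map_neg (μ := 0) (v := 1)
    rw [neg_zero] at hneg
    conv_lhs => rw [← hneg]
    rw [map_measureReal_apply measurable_neg measurableSet_Iic]
    congr 1
    ext t
    simp
  rw [h, ← probReal_compl_eq_one_sub measurableSet_Iic, Set.compl_Iic,
    measureReal_congr Ioi_ae_eq_Ici]

theorem gaussianReal_Icc {w : ℝ} (hw : 0 ≤ w) : gaussianReal 0 1 (Set.Icc (-w) w) =
    ENNReal.ofReal (2 * (gaussianReal 0 1).real (Set.Iic w) - 1) := by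
  rw [← ofReal_measureReal, ← measureReal_congr Ioc_ae_eq_Icc, ← Set.Iic_sdiff_Iic,
    measureReal_sdiff (Set.Iic_subset_Iic.2 (by linarith)) measurableSet_Iic,
    gaussianReal_real_Iic_neg]
  congr 1
  ring

theorem quant_gaussianReal_pos {β : ℝ} (hβ : β ∈ Set.Ioo (1 / 2 : ℝ) 1) :
    0 < quant β (gaussianReal 0 1) := by
  have h := real_Iic_quant (gaussianReal 0 1) (β := β) ⟨by linarith [hβ.1], hβ.2⟩
  have h0 := gaussianReal_real_Iic_neg 0
  rw [neg_zero] at h0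
  by_contra! hle
  have := measureReal_mono (μ := gaussianReal 0 1) (Set.Iic_subset_Iic.2 hle)
  linarith [hβ.1]

theorem gaussianReal_Icc_quant {α : ℝ} (hα : α ∈ Set.Ioo (0 : ℝ) 1) :
    gaussianReal 0 1 (Set.Icc (-quant (1 - α / 2) (gaussianReal 0 1))
      (quant (1 - α / 2) (gaussianReal 0 1))) = ENNReal.ofReal (1 - α) := by
  obtain ⟨h0, h1⟩ := hα
  rw [gaussianReal_Icc (quant_gaussianReal_pos ⟨by linarith, by linarith⟩).le,
    real_Iic_quant _ ⟨by linarith, by linarith⟩]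
  congr 1
  ring

theorem continuousAt_gaussianReal_Icc {z : ℝ} (hz : 0 < z) :
    ContinuousAt (fun w => gaussianReal 0 1 (Set.Icc (-w) w)) z := by
  have h : ContinuousAt
      (fun w => ENNReal.ofReal (2 * (gaussianReal 0 1).real (Set.Iic w) - 1)) z :=
    (ENNReal.continuous_ofReal.comp
      ((continuous_const.mul (continuous_real_Iic _)).sub continuous_const)).continuousAt
  refine h.congr ?_
  filter_upwards [lt_mem_nhds hz] with w hw
  exact (gaussianReal_Icc hw.le).symm

/-! ### Coverage -/

section Coverage

variable {θ : Measure X → ℝ}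
  {κ : (n : ℕ) → Kernel (Fin n → X) ℝ}

/-- Portmanteau theorem: the boundary of the interval is finite, hence Gaussian-null. -/
theorem tendsto_estimatorLaw_abs_le {P : Measure X} [IsProbabilityMeasure P]
    [∀ n, IsMarkovKernel (κ n)] {m N : ℕ → ℕ} (htyp : TypicalLimit P θ κ m N) (w : ℝ) :
    Tendsto (fun n : ℕ => estimatorLaw P κ n
        {t | |√(n : ℝ) * ((t - θ P) / √(sigmaSq P θ κ n))| ≤ w}) atTop
      (𝓝 (gaussianReal 0 1 (Set.Icc (-w) w))) := by
  have hX := htyp.asymp_normal.tendsto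
  have hfr : (gaussianReal 0 1).map (id : ℝ → ℝ) (frontier (Set.Icc (-w) w)) = 0 := by
    rw [Measure.map_id]
    refine Set.Finite.measure_zero ?_ _
    rcases lt_or_ge w (-w) with h | h
    · simp [Set.Icc_eq_empty_of_lt h]
    · rw [frontier_Icc h]
      exact Set.toFinite _
  have := ProbabilityMeasure.tendsto_measure_of_null_frontier_of_tendsto' hX hfr
  simp only [ProbabilityMeasure.coe_mk, Measure.map_id] at this
  refine this.congr fun n => ?_
  rw [Measure.map_apply (by fun_prop) measurableSet_Icc]
  congr 1
  ext t
  simp only [Set.mem_preimage, Set.mem_Icc, Set.mem_ofPred_eq, abs_le]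

variable {n m N : ℕ} (S : PMF (Fin (n / m) × Fin m ↪ Fin n)) (τ : ℝ)

theorem confInterval_apply (hn : 0 < n) (ε α : ℝ) (x : Fin n → X) :
    confInterval θ κ N S ε α x {I | τ ∈ Set.Icc I.1 I.2} =
      ((κ n x).prod (blbVar θ κ N S ((n : ℝ) ^ 2) (1 / n) ε x))
        {p | √(n : ℝ) * |p.1 - τ| ≤ √p.2 * quant (1 - α / 2) (gaussianReal 0 1)} := by
  have hn' : (0 : ℝ) < √(n : ℝ) := Real.sqrt_pos.2 (by exact_mod_cast hn)
  have hI : MeasurableSet {I : ℝ × ℝ | τ ∈ Set.Icc I.1 I.2} := by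
    simp only [Set.mem_Icc]
    exact (measurableSet_le measurable_fst measurable_const).inter
      (measurableSet_le measurable_const measurable_snd)
  rw [confInterval, Measure.map_apply (measurable_intervalEndpoints _ _) hI]
  congr 1
  ext p
  simp only [Set.mem_preimage, Set.mem_Icc, Set.mem_ofPred_eq]
  rw [mul_comm (√(n : ℝ)), ← le_div_iff₀ hn', abs_le]
  constructor <;> rintro ⟨h1, h2⟩ <;> constructor <;> linarith

variable [∀ n, IsMarkovKernel (κ n)]

theorem confInterval_coverage_le (hn : 0 < n) (ε : ℝ) {α : ℝ} (hα : α ∈ Set.Ioo (0 : ℝ) 1)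
    {F : Set ℝ} {hi : ℝ} (hF : ∀ y ∈ F, √y ≤ hi) (x : Fin n → X) :
    confInterval θ κ N S ε α x {I | τ ∈ Set.Icc I.1 I.2} ≤
      κ n x {t | √(n : ℝ) * |t - τ| ≤ hi * quant (1 - α / 2) (gaussianReal 0 1)} +
        blbVar θ κ N S ((n : ℝ) ^ 2) (1 / n) ε x Fᶜ := by
  have hρ : (0 : ℝ) < 1 / n := by positivity
  have hfin : IsFiniteMeasure (blbVar θ κ N S ((n : ℝ) ^ 2) (1 / n) ε x) :=
    ⟨(blbVar_univ_le_one θ κ N S _ ε hρ x).trans_lt ENNReal.one_lt_top⟩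
  have hz := quant_gaussianReal_pos (β := 1 - α / 2) ⟨by linarith [hα.2], by linarith [hα.1]⟩
  rw [confInterval_apply S τ hn]
  refine (measure_mono (t := {t | √(n : ℝ) * |t - τ| ≤
    hi * quant (1 - α / 2) (gaussianReal 0 1)} ×ˢ Set.univ ∪ Set.univ ×ˢ Fᶜ) ?_).trans
    ((measure_union_le _ _).trans ?_)
  · rintro ⟨t, y⟩ hp
    by_cases hy : y ∈ F
    · exact Or.inl ⟨hp.trans (mul_le_mul_of_nonneg_right (hF y hy) hz.le), trivial⟩
    · exact Or.inr ⟨trivial, hy⟩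
  · rw [Measure.prod_prod, Measure.prod_prod, measure_univ (μ := κ n x), one_mul]
    gcongr
    exact mul_le_of_le_one_right' (blbVar_univ_le_one θ κ N S _ ε hρ x)

/-- Unlike the upper bound, this needs `blbVar` to have full mass, since an event of the estimator
alone is lifted to the product law. -/
theorem le_confInterval_coverage (hn : 0 < n) (hs : 0 < n / m) {ε : ℝ} (hε : 0 ≤ ε) {α : ℝ}
    (hα : α ∈ Set.Ioo (0 : ℝ) 1) {F : Set ℝ} {lo : ℝ} (hF : ∀ y ∈ F, lo ≤ √y) (x : Fin n → X) :
    κ n x {t | √(n : ℝ) * |t - τ| ≤ lo * quant (1 - α / 2) (gaussianReal 0 1)} ≤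
      confInterval θ κ N S ε α x {I | τ ∈ Set.Icc I.1 I.2} +
        blbVar θ κ N S ((n : ℝ) ^ 2) (1 / n) ε x Fᶜ := by
  have hρ : (0 : ℝ) < 1 / n := by positivity
  have hprob : IsProbabilityMeasure (blbVar θ κ N S ((n : ℝ) ^ 2) (1 / n) ε x) :=
    ⟨blbVar_univ θ κ N S hs (by positivity) hε hρ x⟩
  have hz := quant_gaussianReal_pos (β := 1 - α / 2) ⟨by linarith [hα.2], by linarith [hα.1]⟩
  rw [confInterval_apply S τ hn]
  calc _ = ((κ n x).prod (blbVar θ κ N S ((n : ℝ) ^ 2) (1 / n) ε x))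
        ({t | √(n : ℝ) * |t - τ| ≤ lo * quant (1 - α / 2) (gaussianReal 0 1)} ×ˢ
          Set.univ) := by
        rw [Measure.prod_prod, measure_univ, mul_one]
    _ ≤ ((κ n x).prod (blbVar θ κ N S ((n : ℝ) ^ 2) (1 / n) ε x))
        ({p | √(n : ℝ) * |p.1 - τ| ≤ √p.2 * quant (1 - α / 2) (gaussianReal 0 1)} ∪
          Set.univ ×ˢ Fᶜ) := by
        refine measure_mono ?_
        rintro ⟨t, y⟩ ⟨ht, -⟩
        by_cases hy : y ∈ F
        · exact Or.inl (le_trans (show √(n : ℝ) * |t - τ| ≤ _ from ht)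
            (mul_le_mul_of_nonneg_right (hF y hy) hz.le))
        · exact Or.inr ⟨trivial, hy⟩
    _ ≤ _ := by
        refine (measure_union_le _ _).trans ?_
        rw [Measure.prod_prod, measure_univ, one_mul]

end Coverage

/-! ### Asymptotics -/

section Asymptotics

variable {m : ℕ → ℕ} {ε : ℕ → ℝ}

/-- If `ε ≤ E`, then `m log n ≤ n ε` forces `n / m ≥ log n / E` before rounding down. -/
theorem tendsto_div_atTop_of_isLittleO (hε : ∀ n, 0 < ε n) (hεb : BddAbove (Set.range ε))
    (hm : Tendsto m atTop atTop)
    (hmn : (fun n => (m n : ℝ)) =o[atTop] fun n : ℕ => (n : ℝ) * ε n / Real.log n) :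
    Tendsto (fun n => n / m n) atTop atTop := by
  obtain ⟨E, hE⟩ := hεb
  have hE' : ∀ n, ε n ≤ E := fun n => hE ⟨n, rfl⟩
  have hE0 : 0 < E := (hε 0).trans_le (hE' 0)
  have hlog : Tendsto (fun n : ℕ => Real.log n) atTop atTop :=
    Real.tendsto_log_atTop.comp tendsto_natCast_atTop_atTop
  rw [tendsto_atTop]
  intro K
  filter_upwards [hmn.bound one_pos, hm.eventually_ge_atTop 1,
    hlog.eventually_ge_atTop ((K + 1) * E), hlog.eventually_gt_atTop 0] with n h1 h2 h3 h4
  have hm0 : (0 : ℝ) < m n := by exact_mod_cast h2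
  rw [Real.norm_of_nonneg hm0.le, Real.norm_of_nonneg
    (div_nonneg (mul_nonneg n.cast_nonneg (hε n).le) h4.le), one_mul, le_div_iff₀ h4] at h1
  rw [Nat.le_div_iff_mul_le h2]
  have h5 : (K : ℝ) * m n * E ≤ n * E := by
    have h6 : (n : ℝ) * ε n ≤ n * E := by gcongr; exact hE' n
    nlinarith [mul_le_mul_of_nonneg_left h3 hm0.le, mul_pos hm0 hE0]
  exact_mod_cast le_of_mul_le_mul_right h5 hE0

theorem eventually_mul_log_le (hε : ∀ n, 0 < ε n) (hεb : BddAbove (Set.range ε))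
    (hm : Tendsto m atTop atTop)
    (hmn : (fun n => (m n : ℝ)) =o[atTop] fun n : ℕ => (n : ℝ) * ε n / Real.log n) {K : ℝ}
    (hK : 0 < K) : ∀ᶠ n : ℕ in atTop, K * Real.log n ≤ (n / m n : ℕ) * ε n := by
  have hlog : Tendsto (fun n : ℕ => Real.log n) atTop atTop :=
    Real.tendsto_log_atTop.comp tendsto_natCast_atTop_atTop
  -- The factor `2` pays for the floor: `n ≤ 2 m ⌊n / m⌋` once there is a block.
  filter_upwards [hmn.bound (by positivity : 0 < 1 / (2 * K)), hm.eventually_ge_atTop 1,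
    hlog.eventually_gt_atTop 0,
    (tendsto_div_atTop_of_isLittleO hε hεb hm hmn).eventually_ge_atTop 1] with n h1 h2 h4 h5
  have hm0 : (0 : ℝ) < m n := by exact_mod_cast h2
  have hεn := hε n
  rw [Real.norm_of_nonneg hm0.le, Real.norm_of_nonneg
    (div_nonneg (mul_nonneg n.cast_nonneg hεn.le) h4.le), ← mul_div_assoc, le_div_iff₀ h4,
    one_div_mul_eq_div, le_div_iff₀ (by positivity)] at h1
  have h6 : (n : ℝ) ≤ m n * (2 * (n / m n : ℕ)) := by
    have : n < m n * (n / m n + 1) := Nat.lt_mul_div_succ n h2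
    have h7 : n ≤ m n * (2 * (n / m n)) :=
      this.le.trans (Nat.mul_le_mul_left _ (by omega))
    exact_mod_cast h7
  have h8 : m n * (K * Real.log n) ≤ m n * ((n / m n : ℕ) * ε n) := by
    nlinarith [mul_le_mul_of_nonneg_right h6 hεn.le]
  exact le_of_mul_le_mul_left h8 hm0

theorem tendsto_blbError (hε : ∀ n, 0 < ε n) (hεb : BddAbove (Set.range ε))
    (hm : Tendsto m atTop atTop)
    (hmn : (fun n => (m n : ℝ)) =o[atTop] fun n : ℕ => (n : ℝ) * ε n / Real.log n) :
    Tendsto (fun n : ℕ => ENNReal.ofReal (97 / 100) ^ (n / m n) + ENNReal.ofReal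
      ((n : ℝ) ^ 2 * Real.exp (-((n / m n : ℕ) * ε n / 16)) / (1 / n))) atTop (𝓝 0) := by
  have h1 : Tendsto (fun n : ℕ => ENNReal.ofReal (97 / 100) ^ (n / m n)) atTop (𝓝 0) :=
    (ENNReal.tendsto_pow_atTop_nhds_zero_of_lt_one
      (ENNReal.ofReal_lt_one.2 (by norm_num))).comp
      (tendsto_div_atTop_of_isLittleO hε hεb hm hmn)
  have h2 : Tendsto (fun n : ℕ =>
      (n : ℝ) ^ 2 * Real.exp (-((n / m n : ℕ) * ε n / 16)) / (1 / n)) atTop (𝓝 0) := by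
    refine squeeze_zero' (Eventually.of_forall fun n => by positivity) ?_
      (tendsto_one_div_atTop_nhds_zero_nat (𝕜 := ℝ))
    -- `64 / 16 = 4`, so the exponential is at most `n ^ (-4)` and beats `n ^ 2 / ρ = n ^ 3`.
    filter_upwards [eventually_mul_log_le hε hεb hm hmn (K := 64) (by norm_num),
      eventually_ge_atTop 1] with n hn h1
    have hn0 : (0 : ℝ) < n := by exact_mod_cast h1
    have hexp : Real.exp (-((n / m n : ℕ) * ε n / 16)) ≤ ((n : ℝ) ^ 4)⁻¹ := by
      calc _ ≤ Real.exp (-(4 * Real.log n)) := Real.exp_le_exp.2 (by linarith)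
        _ = _ := by
          rw [Real.exp_neg, show (4 : ℝ) * Real.log n = ((4 : ℕ) : ℝ) * Real.log n by norm_num,
            Real.exp_nat_mul, Real.exp_log hn0]
    calc _ ≤ (n : ℝ) ^ 2 * ((n : ℝ) ^ 4)⁻¹ / (1 / n) := by gcongr
      _ = 1 / n := by field_simp
  have h3 := h1.add (ENNReal.tendsto_ofReal h2)
  rwa [ENNReal.ofReal_zero, add_zero] at h3

end Asymptotics

/-! ### Squeezing the coverage by dilations -/

theorem sqrt_mem_of_mem_Icc {σ2 d η y : ℝ} (hσ : 0 < σ2) (hη : η ∈ Set.Ioo (0 : ℝ) 1)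
    (hd : d ≤ σ2 * η) (hy : y ∈ Set.Icc (σ2 - d) (σ2 + d)) :
    (1 - η) * √σ2 ≤ √y ∧ √y ≤ (1 + η) * √σ2 := by
  obtain ⟨h0, h1⟩ := hη
  have hs := Real.sq_sqrt hσ.le
  -- The two halves rest on `(1 - η)² ≤ 1 - η` and `1 + η ≤ (1 + η)²`.
  constructor
  · refine Real.le_sqrt_of_sq_le ?_
    rw [mul_pow, hs]
    nlinarith [hy.1, mul_pos hσ h0, mul_pos (mul_pos hσ h0) (sub_pos.2 h1)]
  · refine Real.sqrt_le_iff.2 ⟨by positivity, ?_⟩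
    rw [mul_pow, hs]
    nlinarith [hy.2, mul_pos hσ h0, mul_pos (mul_pos hσ h0) h0]

theorem sqrt_mul_abs_le_iff {n : ℕ} {σ2 : ℝ} (hσ : 0 < σ2) (u w : ℝ) (z : ℝ) :
    √(n : ℝ) * |u| ≤ w * √σ2 * z ↔ |√(n : ℝ) * (u / √σ2)| ≤ w * z := by
  have hs : 0 < √σ2 := Real.sqrt_pos.2 hσ
  rw [abs_mul, abs_div, abs_of_nonneg (Real.sqrt_nonneg (n : ℝ)), abs_of_pos hs, ← mul_div_assoc,
    div_le_iff₀ hs, mul_right_comm]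

/-- A sequence squeezed between `F_n ((1 ± η) z)` up to vanishing errors converges to the limit of
`F_n z`. -/
theorem tendsto_of_dilation_bounds {F : ℕ → ℝ → ℝ≥0∞} {g : ℝ → ℝ≥0∞} {c r : ℕ → ℝ≥0∞} {z : ℝ}
    (hF : ∀ w, Tendsto (fun n => F n w) atTop (𝓝 (g w))) (hg : ContinuousAt g z)
    (hgt : ∀ w, g w ≠ ∞) (hr : Tendsto r atTop (𝓝 0))
    (h : ∀ η ∈ Set.Ioo (0 : ℝ) 1, ∀ᶠ n in atTop,
      F n ((1 - η) * z) ≤ c n + r n ∧ c n ≤ F n ((1 + η) * z) + r n) :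
    Tendsto c atTop (𝓝 (g z)) := by
  have hIoo : Set.Ioo (0 : ℝ) 1 ∈ 𝓝[>] (0 : ℝ) := Ioo_mem_nhdsGT one_pos
  have hlim : ∀ f : ℝ → ℝ, Continuous f → f 0 = z →
      Tendsto (fun η => g (f η)) (𝓝[>] 0) (𝓝 (g z)) := fun f hf h0 => by
    have h1 : Tendsto f (𝓝[>] 0) (𝓝 z) := h0 ▸ hf.continuousAt.tendsto.mono_left nhdsWithin_le_nhds
    exact hg.tendsto.comp h1
  refine tendsto_order.2 ⟨fun a ha => ?_, fun a ha => ?_⟩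
  · obtain ⟨η, hη, hηI⟩ := (((hlim (fun η => (1 - η) * z) (by fun_prop) (by simp)).eventually
      (lt_mem_nhds ha)).and hIoo).exists
    have h1 : Tendsto (fun n => F n ((1 - η) * z) - r n) atTop (𝓝 (g ((1 - η) * z) - 0)) :=
      ENNReal.Tendsto.sub (hF _) hr (Or.inl (hgt _))
    rw [tsub_zero] at h1
    filter_upwards [h1.eventually (lt_mem_nhds hη), h η hηI] with n hn hb
    exact hn.trans_le (tsub_le_iff_right.2 hb.1)
  · obtain ⟨η, hη, hηI⟩ := (((hlim (fun η => (1 + η) * z) (by fun_prop) (by simp)).eventually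
      (gt_mem_nhds ha)).and hIoo).exists
    have h1 := (hF ((1 + η) * z)).add hr
    rw [add_zero] at h1
    filter_upwards [h1.eventually (gt_mem_nhds hη), h η hηI] with n hn hb
    exact hb.2.trans_lt hn

end PrivBoot

end

/-! ### Privacy and asymptotic coverage -/

open PrivBoot in
theorem mainTheorem8 {X : Type*} [MeasurableSpace X]
    (P : Measure X) [IsProbabilityMeasure P]
    (θ : Measure X → ℝ)
    (hθ : ∀ k : ℕ, Measurable fun x : Fin k → X => θ (PrivBoot.empirical x))
    (κ : (n : ℕ) → Kernel (Fin n → X) ℝ) [∀ n, IsMarkovKernel (κ n)]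
    (ε δ : ℕ → ℝ) (hε : ∀ n, 0 < ε n) (hεb : BddAbove (Set.range ε)) (hδ : ∀ n, 0 ≤ δ n)
    (hκ : ∀ n, PrivBoot.IsDP (κ n) (ε n) (δ n))
    (m N : ℕ → ℕ) (hN : ∀ n, 0 < N n)
    (hm : Tendsto m atTop atTop)
    (hmn : (fun n => (m n : ℝ)) =o[atTop] fun n : ℕ => (n : ℝ) * ε n / Real.log n)
    (S : (n : ℕ) → PMF (Fin (n / m n) × Fin (m n) ↪ Fin n))
    (htyp : PrivBoot.TypicalLimit P θ κ m N)
    (hσ_pos : ∃ c : ℝ, 0 < c ∧ ∀ᶠ n in atTop, c ≤ PrivBoot.sigmaSq P θ κ n)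
    (hσ_max : ∃ c : ℝ, c < 1 ∧ ∀ᶠ n : ℕ in atTop, PrivBoot.sigmaSq P θ κ n ≤ c * (n : ℝ) ^ 2)
    (α : ℝ) (hα : α ∈ Set.Ioo (0 : ℝ) 1) :
    (∀ n, PrivBoot.IsDP (PrivBoot.confInterval θ κ (N n) (S n) (ε n) α) (2 * ε n) (δ n)) ∧
    Tendsto
      (fun n => ∫⁻ x, PrivBoot.confInterval θ κ (N n) (S n) (ε n) α x
          {I | θ P ∈ Set.Icc I.1 I.2} ∂(Measure.pi fun _ : Fin n => P))
      atTop (𝓝 (ENNReal.ofReal (1 - α))) := by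
  refine ⟨fun n => confInterval_isDP θ κ (N n) (S n) (hε n).le (hκ n) α, ?_⟩
  obtain ⟨c, hc, hσc⟩ := hσ_pos
  obtain ⟨c', hc', hσc'⟩ := hσ_max
  obtain ⟨Δ, hΔ, hboot⟩ := htyp.boot_accuracy
  have hz := quant_gaussianReal_pos (β := 1 - α / 2) ⟨by linarith [hα.2], by linarith [hα.1]⟩
  have hd : Tendsto (fun n : ℕ => Δ n + 1 / (n : ℝ)) atTop (𝓝 0) := by
    simpa using hΔ.add (tendsto_one_div_atTop_nhds_zero_nat (𝕜 := ℝ))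
  rw [← gaussianReal_Icc_quant hα]
  refine tendsto_of_dilation_bounds (tendsto_estimatorLaw_abs_le htyp)
    (continuousAt_gaussianReal_Icc hz) (fun w => measure_ne_top _ _)
    (tendsto_blbError hε hεb hm hmn) fun η hη => ?_
  -- The threshold `c * η` makes the error at most `η σ_n²`; `1 - c'` keeps the upper end of the
  -- window below `n ^ 2`, as `n ^ 2 ≥ 1`; and `Δ n < c` keeps `σ_n² - Δ n` nonnegative.
  filter_upwards [hσc, hσc', hboot, hd.eventually (gt_mem_nhds (mul_pos hc hη.1)),
    hd.eventually (gt_mem_nhds (sub_pos.2 hc')), hΔ.eventually (gt_mem_nhds hc),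
    eventually_ge_atTop 1,
    (tendsto_div_atTop_of_isLittleO hε hεb hm hmn).eventually_ge_atTop 1]
    with n hσ hσ' hb hd1 hd2 hΔn hn hs
  have hn1 : (1 : ℝ) ≤ n := by exact_mod_cast hn
  have hρ : (0 : ℝ) < 1 / n := by positivity
  have hσ0 : 0 < sigmaSq P θ κ n := hc.trans_le hσ
  set σ2 := sigmaSq P θ κ n with hσ2
  have hset : {v : ℝ | |σ2 - v| ≤ Δ n} = Set.Icc (σ2 - Δ n) (σ2 + Δ n) := by
    ext v
    simp only [Set.mem_ofPred_eq, Set.mem_Icc, abs_le]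
    constructor <;> rintro ⟨h1, h2⟩ <;> constructor <;> linarith
  rw [hset] at hb
  have hmax : σ2 + Δ n + 1 / n ≤ (n : ℝ) ^ 2 := by
    nlinarith [mul_nonneg (sub_pos.2 hc').le (sub_nonneg.2 (one_le_pow₀ hn1 (n := 2)))]
  have hacc := lintegral_blbVar_compl_Icc_le hθ hs (S n) (σmax2 := (n : ℝ) ^ 2) (hε n).le hρ
    (by linarith) hmax hb
  set F := Set.Icc (σ2 - Δ n - 1 / n) (σ2 + Δ n + 1 / n) with hF
  have hFs : ∀ y ∈ F, (1 - η) * √σ2 ≤ √y ∧ √y ≤ (1 + η) * √σ2 := fun y hy =>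
    sqrt_mem_of_mem_Icc (d := Δ n + 1 / n) hσ0 hη
      (hd1.le.trans (mul_le_mul_of_nonneg_right hσ hη.1.le))
      ⟨by linarith [hy.1], by linarith [hy.2]⟩
  have hBm : Measurable fun x => blbVar θ κ (N n) (S n) ((n : ℝ) ^ 2) (1 / n) (ε n) x Fᶜ :=
    measurable_blbVar_apply hθ (S n) _ _ hρ measurableSet_Icc.compl
  have hlaw : ∀ w : ℝ, estimatorLaw P κ n {t | |√(n : ℝ) * ((t - θ P) / √σ2)| ≤
        w * quant (1 - α / 2) (gaussianReal 0 1)} =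
      ∫⁻ x, κ n x {t | √(n : ℝ) * |t - θ P| ≤ w * √σ2 * quant (1 - α / 2) (gaussianReal 0 1)}
        ∂(Measure.pi fun _ : Fin n => P) := by
    intro w
    simp_rw [sqrt_mul_abs_le_iff hσ0]
    rw [estimatorLaw, Measure.bind_apply _ (κ n).measurable.aemeasurable]
    exact measurableSet_le (by fun_prop) measurable_const
  rw [hlaw, hlaw]
  constructor
  · refine (lintegral_mono fun x => le_confInterval_coverage (θ := θ) (N := N n) (S n) (θ P) hn hs
      (hε n).le hα (fun y hy => (hFs y hy).1) x).trans ?_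
    rw [lintegral_add_right _ hBm]
    gcongr
  · refine (lintegral_mono fun x => confInterval_coverage_le (S n) (θ P) hn (ε n) hα
      (fun y hy => (hFs y hy).2) x).trans ?_
    rw [lintegral_add_right _ hBm]
    gcongr
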